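/- Let $I=\{1,\dots,n\}$, $I^*=\{1^*,\dots,n^*\}$, $J=I\sqcup I^*$, with the involution $i\leftrightarrow i^*$, and let $J_n$ be the collection of admissible $n$-subsets $A$ of $J$ (those with $A\cap A^*=\emptyset$). Write $X\Delta Y$ for the symmetric difference. \emph{Oriented matroids.} An oriented matroid $M$ of rank $k$ on $I$ is a chirotope $\chi:I^k\to\{+1,-1,0\}$ up to a global sign. A real $k\times n$ matrix $\mathbf B$ represents $M$ if $M$ is the class of $\chi(S)=\operatorname{sign}\det(\text{columns } S \text{ of } \mathbf B)$. For $A\subseteq I$ let $\chi(A)$ be the value of $\chi$ at the increasing list of $A$ if $\#A=k$, and $0$ otherwise. \emph{Oriented orthogonal Lagrangian matroids.} For an admissible set $\{a_1,\dots,a_n\}\subset J$ consider the partial order $a_1\prec\dots\prec a_{n-1}\prec\{a_n,a_n^*\}\prec a_{n-1}^*\prec\dots\prec a_1^*$ on $J$, with $a_n,a_n^*$ incomparable. For $X,Y\in J_n$, listed increasingly, $X\preceq Y$ means $x_i\preceq y_i$ for all $i$. A collection $\mathcal B\subseteq J_n$ is a Lagrangian orthogonal matroid if for every such order it has a greatest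 element. An oriented orthogonal Lagrangian matroid is a map $p:J_n\to\{+1,-1,0\}$, up to a global sign, such that $\{A: p(A)\ne0\}$ (the bases) is a Lagrangian orthogonal matroid and the map $p'$ on subsets of $I$ given by $p'(A\cap I)=p(A)$ is an oriented even $\Delta$-matroid: (1) $p'\not\equiv0$; (2) all $A$ with $p'(A)\neq 0$ have the same cardinality mod $2$; (3) if $A\Delta B=\{i_1<\dots<i_l\}$, $w\in\{\pm1\}$ and $\kappa_j=w(-1)^jp'(A\Delta\{i_j\})p'(B\Delta\{i_j\})\ge0$ for all $j$, then all $\kappa_j=0$. \emph{Orthogonal representations.} Let $\mathbf C$ be an $n\times 2n$ real matrix with columns indexed by $J$, whose rows form a basis of a totally isotropic subspace for the symmetric form on $\mathbb R^J$ with $e_i\cdot e_{i^*}=1$ and all other products of basis vectors $0$. Call $F\in J_n$ a basis of $\mathbf C$ if the $n\times n$ minor of $\mathbf C$ with columns $F$ is non-zero. For a basis $F$ of $\mathbf C$ put $T=F\cap I$, swap columns $j$ and $j^*$ of $\mathbf C$ for $j\in T$, row-reduce to $(\mathbf A'\ \mathbf 1)$, set $\varepsilon_i=(-1)^{\#\{t\in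 T:\,t\le i\}}$ and $a_{ij}=\varepsilon_i\varepsilon_ja'_{ij}$, and assign to $X\in J_n$ the sign of the Pfaffian of the principal submatrix of $\mathbf A=(a_{ij})$ indexed by $(X\Delta F)\cap I$ (Pfaffians of odd size are $0$, that of the empty matrix is $1$). $\mathbf C$ is an orthogonal representation of the oriented orthogonal Lagrangian matroid $P$ if the bases of $P$ are exactly the bases of $\mathbf C$ and, for every choice of the basis $F$, the resulting signs are those of $P$ up to a global sign. \textbf{Theorem.} Let $M$ be an oriented matroid of rank $k$ on $I$, represented by the real $k\times n$ matrix $\mathbf B$ (columns indexed by $I$), and let $\mathbf D$ (columns indexed by $I^*$) be a matrix whose rows form a basis of the orthogonal complement of the row space of $\mathbf B$ in $\mathbb R^n$. Then $p(A)=\chi(A\cap I)$, with $\chi$ a chirotope of $M$, defines an oriented orthogonal Lagrangian matroid (the one corresponding to $M$), and $$\begin{pmatrix}\mathbf B&0\\0&\mathbf D\end{pmatrix}$$ is an orthogonal representation of it. -/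

import Mathlib

open scoped symmDiff

noncomputable section

namespace OriOrth

/-! ### Classical oriented matroids -/

/-- A chirotope of rank `k` on `I = Fin n`. In `exchange`, the index `o` is the first position, so
that `Function.update x o (y i)` is `(y i, x₂, …, x_k)`. -/
structure Chirotope (n k : ℕ) where
  toFun : (Fin k → Fin n) → SignType
  not_zero : ∃ x, toFun x ≠ 0
  alternating : ∀ (x : Fin k → Fin n) (σ : Equiv.Perm (Fin k)),
    (toFun (x ∘ σ) : ℤ) = (Equiv.Perm.sign σ : ℤ) * (toFun x : ℤ)
  exchange : ∀ o : Fin k, (o : ℕ) = 0 → ∀ x y : Fin k → Fin n,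
    (∀ i, 0 ≤ toFun (Function.update x o (y i)) * toFun (Function.update y i (x o))) →
      0 ≤ toFun x * toFun y

/-- Two chirotopes are equivalent when they agree up to a global sign. -/
instance Chirotope.setoid (n k : ℕ) : Setoid (Chirotope n k) where
  r χ₁ χ₂ := (∀ x, χ₁.toFun x = χ₂.toFun x) ∨ (∀ x, χ₁.toFun x = -χ₂.toFun x)
  iseqv :=
    { refl := fun _ => Or.inl fun _ => rfl
      symm := by
        rintro χ₁ χ₂ (h | h)
        · exact Or.inl fun x => (h x).symm
        · exact Or.inr fun x => by rw [h x, neg_neg]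
      trans := by
        rintro χ₁ χ₂ χ₃ (h | h) (h' | h')
        · exact Or.inl fun x => by rw [h x, h' x]
        · exact Or.inr fun x => by rw [h x, h' x]
        · exact Or.inr fun x => by rw [h x, h' x]
        · exact Or.inl fun x => by rw [h x, h' x, neg_neg] }

/-- An oriented matroid of rank `k` on `I = Fin n`: a chirotope up to sign. -/
def OrientedMatroid (n k : ℕ) : Type := Quotient (Chirotope.setoid n k)

/-- A chirotope as a function on all subsets of `I`: a `k`-subset is listed in increasing order,
and sets of any other cardinality get the value `0`. -/
def Chirotope.onSets {n k : ℕ} (χ : Chirotope n k) (A : Finset (Fin n)) : SignType :=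
  if h : A.card = k then χ.toFun (A.orderEmbOfFin h) else 0

/-- The `k × n` real matrix `B` represents `M`: `M` is the class of the chirotope
`S ↦ sign det (columns S of B)`. -/
def OrientedMatroid.IsRepresentedBy {n k : ℕ} (M : OrientedMatroid n k)
    (B : Matrix (Fin k) (Fin n) ℝ) : Prop :=
  ∃ χ : Chirotope n k, (Quotient.mk _ χ : OrientedMatroid n k) = M ∧
    ∀ S : Fin k → Fin n, χ.toFun S = SignType.sign (B.submatrix id S).det

/-- The rows of `D` form a basis of the orthogonal complement (for the standard scalar product)
of the row space of `B`. -/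
def IsOrthogonalComplement {n k l : ℕ} (B : Matrix (Fin k) (Fin n) ℝ)
    (D : Matrix (Fin l) (Fin n) ℝ) : Prop :=
  LinearIndependent ℝ D.row ∧
    ∀ v : Fin n → ℝ, v ∈ Submodule.span ℝ (Set.range D.row) ↔
      ∀ u ∈ Submodule.span ℝ (Set.range B.row), u ⬝ᵥ v = 0

/-! ### Oriented even Δ-matroids -/

/-- Sign maps `2^I → {+1, -1, 0}` that describe an oriented even Δ-matroid. In `exchange`,
the exponent of `-1` at `i` is the position (counted from one) of `i` in the increasing list of
the elements of `A ∆ B`. -/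
structure IsOrientedEvenDeltaMatroid {n : ℕ} (p : Finset (Fin n) → SignType) : Prop where
  not_zero : ∃ A, p A ≠ 0
  parity : ∀ A B, p A ≠ 0 → p B ≠ 0 → A.card ≡ B.card [MOD 2]
  exchange : ∀ (A B : Finset (Fin n)) (w : SignType), w ≠ 0 →
    (∀ i ∈ A ∆ B,
      0 ≤ w * (-1) ^ ((A ∆ B).filter (· ≤ i)).card * (p (A ∆ {i}) * p (B ∆ {i}))) →
    ∀ i ∈ A ∆ B,
      w * (-1) ^ ((A ∆ B).filter (· ≤ i)).card * (p (A ∆ {i}) * p (B ∆ {i})) = 0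

/-! ### Lagrangian orthogonal matroids -/

/-- The set `J = I ⊔ I^*`: `Sum.inl i` is `i` and `Sum.inr i` is `i^*`. -/
abbrev J (n : ℕ) : Type := Fin n ⊕ Fin n

/-- The involution `*` on `J`. -/
abbrev star {n : ℕ} : J n → J n := Sum.swap

/-- A subset of `J` is admissible if it is disjoint from its image under `*`. -/
def Admissible {n : ℕ} (A : Finset (J n)) : Prop := Disjoint A (A.image star)

/-- The collection `J_n` of admissible `n`-element subsets of `J`. -/
abbrev LagrangianSet (n : ℕ) : Type := {A : Finset (J n) // Admissible A ∧ A.card = n}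

/-- The element of `J_n` that meets `I` in `A`. -/
def completion {n : ℕ} (A : Finset (Fin n)) : LagrangianSet n :=
  ⟨A.disjSum Aᶜ, by
    refine ⟨?_, by simp [Finset.card_disjSum, Finset.card_compl,
      Nat.add_sub_cancel' (by simpa using Finset.card_le_univ A)]⟩
    rw [Admissible, Finset.disjoint_left]
    rintro (i | i) hi hj <;> simp_all [Finset.mem_disjSum]⟩

/-- The list `a` enumerates an admissible set of `n` elements. -/
def IsFrame {n : ℕ} (a : Fin n → J n) : Prop :=
  Function.Injective a ∧ ∀ i j, a i ≠ star (a j)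

/-- The strict `D_n`-admissible partial order
`a₁ ≺ ⋯ ≺ a_{n-1} ≺ {a_n, a_n^*} ≺ a_{n-1}^* ≺ ⋯ ≺ a₁^*`, where `a_n` and `a_n^*` are
incomparable. -/
inductive DLt {n : ℕ} (a : Fin n → J n) : J n → J n → Prop
  | unstarred (i j : Fin n) : i < j → DLt a (a i) (a j)
  | starred (i j : Fin n) : i < j → DLt a (star (a j)) (star (a i))
  | mixed (i j : Fin n) : ((i : ℕ) + 1 < n ∨ (j : ℕ) + 1 < n) → DLt a (a i) (star (a j))

/-- The (reflexive) Gale order on `J_n` induced by the order `DLt a` on `J`. -/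
def GaleLE {n : ℕ} (a : Fin n → J n) (X Y : LagrangianSet n) : Prop :=
  ∃ x y : Fin n → J n,
    (∀ i j, i < j → DLt a (x i) (x j)) ∧ (∀ i j, i < j → DLt a (y i) (y j)) ∧
    Finset.univ.image x = X.1 ∧ Finset.univ.image y = Y.1 ∧
    ∀ i, x i = y i ∨ DLt a (x i) (y i)

/-- A Lagrangian orthogonal matroid: for each `D_n`-admissible ordering of `J` the collection
has a greatest element in the Gale order. -/
def IsLagrangianOrthogonalMatroid {n : ℕ} (𝓑 : Set (LagrangianSet n)) : Prop :=
  ∀ a : Fin n → J n, IsFrame a → ∃ Y ∈ 𝓑, ∀ X ∈ 𝓑, GaleLE a X Y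

/-- A Lagrangian orthogonal matroid with signs on its bases, such that forgetting the starred
elements gives an oriented even Δ-matroid. -/
structure OrthogonalSignMap (n : ℕ) where
  toFun : LagrangianSet n → SignType
  orthogonal : IsLagrangianOrthogonalMatroid {A | toFun A ≠ 0}
  oriented : IsOrientedEvenDeltaMatroid fun A => toFun (completion A)

/-- Two sign maps are equivalent when they agree up to a global sign. -/
instance OrthogonalSignMap.setoid (n : ℕ) : Setoid (OrthogonalSignMap n) where
  r p q := (∀ A, p.toFun A = q.toFun A) ∨ (∀ A, p.toFun A = -q.toFun A)
  iseqv :=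
    { refl := fun _ => Or.inl fun _ => rfl
      symm := by
        rintro p q (h | h)
        · exact Or.inl fun x => (h x).symm
        · exact Or.inr fun x => by rw [h x, neg_neg]
      trans := by
        rintro p q r (h | h) (h' | h')
        · exact Or.inl fun x => by rw [h x, h' x]
        · exact Or.inr fun x => by rw [h x, h' x]
        · exact Or.inr fun x => by rw [h x, h' x]
        · exact Or.inl fun x => by rw [h x, h' x, neg_neg] }

/-- An oriented orthogonal (Lagrangian) matroid: a sign map as above, up to a global sign. -/
def OrientedOrthogonalMatroid (n : ℕ) : Type := Quotient (OrthogonalSignMap.setoid n)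

/-- `P` is the oriented orthogonal Lagrangian matroid that corresponds to the oriented matroid
`M`: the sign of `A ∈ J_n` is the value of the chirotope at `A ∩ I` (zero unless `A ∩ I` has
`k` elements). -/
def OrientedMatroid.CorrespondsTo {n k : ℕ} (M : OrientedMatroid n k)
    (P : OrientedOrthogonalMatroid n) : Prop :=
  ∃ (χ : Chirotope n k) (p : OrthogonalSignMap n),
    (Quotient.mk _ χ : OrientedMatroid n k) = M ∧
    (Quotient.mk _ p : OrientedOrthogonalMatroid n) = P ∧
    ∀ A : LagrangianSet n, p.toFun A = χ.onSets A.1.toLeft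

/-! ### Orthogonal representations -/

/-- The symmetric bilinear form on `ℝ^J` with `e_i e_{i^*} = 1` and all other products of basis
vectors zero. -/
def orthForm {n : ℕ} (u v : J n → ℝ) : ℝ := ∑ c : J n, u c * v (star c)

/-- The rows of `C` form a basis of an `n`-dimensional totally isotropic subspace of the
orthogonal space `ℝ^J`. -/
def IsLagrangianMatrix {n : ℕ} {ρ : Type} [Fintype ρ] (C : Matrix ρ (J n) ℝ) : Prop :=
  Fintype.card ρ = n ∧ LinearIndependent ℝ C.row ∧
    ∀ u ∈ Submodule.span ℝ (Set.range C.row), ∀ v ∈ Submodule.span ℝ (Set.range C.row),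
      orthForm u v = 0

/-- The maximal minor of `C` with columns `F` (in any order) is non-zero. -/
def IsBasisOf {n : ℕ} {ρ : Type} [Fintype ρ] [DecidableEq ρ] (C : Matrix ρ (J n) ℝ)
    (F : LagrangianSet n) : Prop :=
  ∃ e : ρ ≃ F.1, (C.submatrix id fun r => (e r : J n)).det ≠ 0

/-- Swap the columns `j` and `j^*` of `C` for all `j ∈ T`. -/
def swapColumns {n : ℕ} {ρ : Type} (C : Matrix ρ (J n) ℝ) (T : Finset (Fin n)) :
    Matrix ρ (J n) ℝ :=
  Matrix.of fun r c => if Sum.elim id id c ∈ T then C r (star c) else C r c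

/-- Invertible row operations turn `C` into the matrix `(A  1)`. -/
def RowReducesTo {n : ℕ} {ρ : Type} [Fintype ρ] [DecidableEq ρ] (C : Matrix ρ (J n) ℝ)
    (A : Matrix (Fin n) (Fin n) ℝ) : Prop :=
  ∃ (R : Matrix (Fin n) ρ ℝ) (Q : Matrix ρ (Fin n) ℝ), R * Q = 1 ∧ Q * R = 1 ∧
    R * C = Matrix.fromCols A (1 : Matrix (Fin n) (Fin n) ℝ)

/-- The sign `ε_i`: it starts from `ε_0 = 1` and changes at each element of `T`. -/
def eps {n : ℕ} (T : Finset (Fin n)) (i : Fin n) : ℝ := (-1) ^ (T.filter (· ≤ i)).card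

/-- The matrix `a_{ij} = ε_i ε_j a'_{ij}`. -/
def twist {n : ℕ} (T : Finset (Fin n)) (A' : Matrix (Fin n) (Fin n) ℝ) :
    Matrix (Fin n) (Fin n) ℝ :=
  Matrix.of fun i j => eps T i * eps T j * A' i j

/-- The Pfaffian of a skew-symmetric matrix of size `2m`, as a sum over the permutations `σ`
with `σ(2k-1) = min {σ(j) : 2k-1 ≤ j ≤ 2m}` for `1 ≤ k ≤ m` (here positions start at `0`). -/
def pfaffian {m : ℕ} (A : Matrix (Fin (2 * m)) (Fin (2 * m)) ℝ) : ℝ :=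
  ∑ σ ∈ (Finset.univ : Finset (Equiv.Perm (Fin (2 * m)))).filter
      (fun σ => ∀ (k : Fin m) (j : Fin (2 * m)), 2 * (k : ℕ) ≤ (j : ℕ) →
        σ ⟨2 * k, by omega⟩ ≤ σ j),
    ((Equiv.Perm.sign σ : ℤ) : ℝ) *
      ∏ k : Fin m, A (σ ⟨2 * k, by omega⟩) (σ ⟨2 * k + 1, by omega⟩)

/-- The Pfaffian of the principal minor of `A` indexed by `S`; it is `0` if `S` has odd size. -/
def pfaffianMinor {n : ℕ} (A : Matrix (Fin n) (Fin n) ℝ) (S : Finset (Fin n)) : ℝ :=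
  if h : S.card = 2 * (S.card / 2) then
    pfaffian (A.submatrix (S.orderEmbOfFin h) (S.orderEmbOfFin h))
  else 0

/-- `C` is an orthogonal representation of the oriented orthogonal Lagrangian matroid `P`.
The row space of `C` is Lagrangian, the bases of `P` are the admissible `n`-sets of columns with
non-zero minor, and, whichever basis `F` the procedure starts from, the procedure
(with `T = F ∩ I`: swap the columns of `T` with their starred partners, row-reduce to `(A'  1)`,
multiply the entries of `A'` by `ε_i ε_j`, give `X` the sign of the Pfaffian of the principal
minor indexed by `(X ∆ F) ∩ I`) produces the signs of `P`, up to a global sign `w`. -/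
def OrientedOrthogonalMatroid.IsRepresentedBy {n : ℕ} (P : OrientedOrthogonalMatroid n)
    {ρ : Type} [Fintype ρ] [DecidableEq ρ] (C : Matrix ρ (J n) ℝ) : Prop :=
  IsLagrangianMatrix C ∧
  ∃ p : OrthogonalSignMap n, (Quotient.mk _ p : OrientedOrthogonalMatroid n) = P ∧
    (∀ F : LagrangianSet n, p.toFun F ≠ 0 ↔ IsBasisOf C F) ∧
    ∀ F : LagrangianSet n, IsBasisOf C F →
      ∃ A' : Matrix (Fin n) (Fin n) ℝ,
        RowReducesTo (swapColumns C F.1.toLeft) A' ∧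
        ∃ w : SignType, w ≠ 0 ∧ ∀ X : LagrangianSet n,
          p.toFun X =
            w * SignType.sign (pfaffianMinor (twist F.1.toLeft A') (X.1 ∆ F.1).toLeft)

end OriOrth

end

/-!
Write `plucker B S` for the minor of `B` with columns `S` in increasing order, and zero if `S` does
not have `k` elements; the sign map in question is `A ↦ sign (plucker B (A ∩ I))`.

The central fact is that the Grassmann–Plücker relations, written with symmetric differences, read
`∑ i ∈ X ∆ Y, ± plucker B (X ∆ {i}) * plucker B (Y ∆ {i}) = 0` (`sum_plucker_symmDiff`), where the
signs alternate along the increasing list of `X ∆ Y`. They follow from Cramer's relation between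
`k + 1` columns. They are also the relations between the Pfaffian minors of a skew-symmetric matrix,
and they are used twice.

* They give the exchange property of an oriented even Δ-matroid at once: real numbers that are all
  non-negative and add up to zero are all zero (`isOrientedEvenDeltaMatroid_plucker`).
* For a basis `T`, the relation for `T ∆ {min U}` and `T ∆ (U \ {min U})` is the expansion of a
  Pfaffian along its first row. By induction on `U`, the quotients `plucker B (T ∆ U) / plucker B T`
  are the Pfaffian minors of any matrix that has the right entries above the diagonal, that is, the
  right values for two-element sets `U` (`pfaffianMinor_eq_div`).

The row reduction of the block matrix at a basis `F` with `T = F ∩ I` leaves the matrix with blocks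
`N` and `-Nᵀ`, where `N` holds the coordinates of the columns outside `T` of `B` in the basis `T`
(`rowReducesTo_skewBlock`). By Cramer's rule such a coordinate is, up to the sign of a reordering,
the quotient of the Plücker coordinates of two bases that differ by one exchange, and the signs
`ε_i ε_j` make up for the reordering (`twist_skewBlock_mul`). So the Pfaffian procedure yields the
signs of the Plücker coordinates, up to the sign of `plucker B T`.

A `D_n`-admissible order turns into a weight function on `I`, positive on the elements wanted in
`A ∩ I` and negative on the others. A basis of greatest weight meets every upper level set of the
weight as much as a basis can (`exists_greedy_basis`), which gives the Gale order
(`isLagrangianOrthogonalMatroid_plucker`); the incomparable pair `a_n, a_n^*` does no harm, because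
all bases of the matroid have the same number of elements.
-/

namespace OriOrth

/-! ### Plücker coordinates -/

theorem sum_eq_sum_orderEmbOfFin {n m : ℕ} (A : Finset (Fin n)) (h : A.card = m)
    (g : Fin n → ℝ) : ∑ a ∈ A, g a = ∑ p, g (A.orderEmbOfFin h p) := by
  conv_lhs => rw [← Finset.map_orderEmbOfFin_univ A h]
  rw [Finset.sum_map]
  rfl

theorem exists_orderEmbOfFin_eq {n m : ℕ} {A : Finset (Fin n)} (h : A.card = m) {a : Fin n}
    (ha : a ∈ A) : ∃ p, A.orderEmbOfFin h p = a := by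
  have := Finset.range_orderEmbOfFin A h
  have h' : a ∈ Set.range (A.orderEmbOfFin h) := by rw [this]; exact ha
  exact h'

theorem orderEmbOfFin_erase {n m : ℕ} {A : Finset (Fin n)} (h : A.card = m + 1)
    (p : Fin (m + 1)) (h' : (A.erase (A.orderEmbOfFin h p)).card = m) :
    ⇑((A.erase (A.orderEmbOfFin h p)).orderEmbOfFin h') = A.orderEmbOfFin h ∘ p.succAbove := by
  symm
  apply Finset.orderEmbOfFin_unique
  · intro q
    refine Finset.mem_erase.2 ⟨?_, Finset.orderEmbOfFin_mem _ _ _⟩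
    intro hq
    exact Fin.succAbove_ne p q ((A.orderEmbOfFin h).injective hq)
  · exact (A.orderEmbOfFin h).strictMono.comp (Fin.strictMono_succAbove p)

/-- The number of elements of `A` below `a`. -/
def below {n : ℕ} (A : Finset (Fin n)) (a : Fin n) : ℕ := (A.filter (· < a)).card

theorem below_orderEmbOfFin {n m : ℕ} (A : Finset (Fin n)) (h : A.card = m) (p : Fin m) :
    below A (A.orderEmbOfFin h p) = p := by
  have : A.filter (· < A.orderEmbOfFin h p) =
      (Finset.Iio p).map (A.orderEmbOfFin h).toEmbedding := by
    ext a
    simp only [Finset.mem_filter, Finset.mem_map, Finset.mem_Iio]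
    constructor
    · rintro ⟨ha, hlt⟩
      obtain ⟨q, rfl⟩ := exists_orderEmbOfFin_eq h ha
      exact ⟨q, (A.orderEmbOfFin h).lt_iff_lt.1 hlt, rfl⟩
    · rintro ⟨q, hq, rfl⟩
      exact ⟨Finset.orderEmbOfFin_mem _ _ _, (A.orderEmbOfFin h).lt_iff_lt.2 hq⟩
  rw [below, this]
  simp

theorem below_erase_of_le {n : ℕ} {T : Finset (Fin n)} {t j : Fin n} (h : j ≤ t) :
    below (T.erase t) j = below T j := by
  unfold below
  congr 1
  ext x
  simp only [Finset.mem_filter, Finset.mem_erase]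
  exact ⟨fun h' => ⟨h'.1.2, h'.2⟩, fun h' => ⟨⟨(h'.2.trans_le h).ne, h'.1⟩, h'.2⟩⟩

theorem card_filter_le_of_mem {n : ℕ} {T : Finset (Fin n)} {i : Fin n} (h : i ∈ T) :
    (T.filter (· ≤ i)).card = below T i + 1 := by
  have : T.filter (· ≤ i) = insert i (T.filter (· < i)) := by
    ext x
    simp only [Finset.mem_filter, Finset.mem_insert, le_iff_lt_or_eq]
    constructor
    · tauto
    · rintro (rfl | h')
      · exact ⟨h, Or.inr rfl⟩
      · exact ⟨h'.1, Or.inl h'.2⟩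
  rw [this, Finset.card_insert_of_notMem (by simp), below]

theorem card_symmDiff_add_card_inter {n : ℕ} (S T : Finset (Fin n)) :
    (S ∆ T).card + 2 * (S ∩ T).card = S.card + T.card := by
  have e1 := Finset.card_sdiff_add_card_inter S T
  have e2 := Finset.card_sdiff_add_card_inter T S
  have e3 : (S ∆ T).card = (S \ T).card + (T \ S).card := by
    rw [Finset.symmDiff_def, Finset.card_union_of_disjoint disjoint_sdiff_sdiff]
  rw [Finset.inter_comm T S] at e2
  omega

/-- The Plücker coordinate of `B` at the set `S` of columns, listed in increasing order; sets of
the wrong size get `0`. -/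
def plucker {n k : ℕ} (B : Matrix (Fin k) (Fin n) ℝ) (S : Finset (Fin n)) : ℝ :=
  if h : S.card = k then (B.submatrix id (S.orderEmbOfFin h)).det else 0

theorem plucker_of_card {n k : ℕ} (B : Matrix (Fin k) (Fin n) ℝ) {S : Finset (Fin n)}
    (h : S.card = k) : plucker B S = (B.submatrix id (S.orderEmbOfFin h)).det := dif_pos h

theorem plucker_of_card_ne {n k : ℕ} (B : Matrix (Fin k) (Fin n) ℝ) {S : Finset (Fin n)}
    (h : S.card ≠ k) : plucker B S = 0 := dif_neg h

theorem card_of_plucker_ne_zero {n k : ℕ} {B : Matrix (Fin k) (Fin n) ℝ} {S : Finset (Fin n)}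
    (h : plucker B S ≠ 0) : S.card = k := by
  by_contra h'
  exact h (plucker_of_card_ne B h')

/-- The linear form `v ↦ det (v, columns S of B)` attached to a set `S` of one column fewer than
`B` has rows. -/
def pluckerForm {n m : ℕ} (B : Matrix (Fin (m + 1)) (Fin n) ℝ) (S : Finset (Fin n))
    (h : S.card = m) : (Fin (m + 1) → ℝ) →ₗ[ℝ] ℝ where
  toFun v := ∑ r : Fin (m + 1), (-1) ^ (r : ℕ) * v r *
    (B.submatrix r.succAbove (S.orderEmbOfFin h)).det
  map_add' u v := by
    simp only [Pi.add_apply, mul_add, add_mul, Finset.sum_add_distrib]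
  map_smul' c v := by
    simp only [Pi.smul_apply, smul_eq_mul, RingHom.id_apply, Finset.mul_sum]
    exact Finset.sum_congr rfl fun _ _ => by ring

theorem pluckerForm_apply {n m : ℕ} (B : Matrix (Fin (m + 1)) (Fin n) ℝ) (S : Finset (Fin n))
    (h : S.card = m) (v : Fin (m + 1) → ℝ) : pluckerForm B S h v =
      ∑ r : Fin (m + 1), (-1) ^ (r : ℕ) * v r *
        (B.submatrix r.succAbove (S.orderEmbOfFin h)).det := rfl

theorem pluckerForm_of_mem {n m : ℕ} (B : Matrix (Fin (m + 1)) (Fin n) ℝ) {S : Finset (Fin n)}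
    (h : S.card = m) {i : Fin n} (hi : i ∈ S) : pluckerForm B S h (fun r => B r i) = 0 := by
  obtain ⟨p, rfl⟩ := exists_orderEmbOfFin_eq h hi
  have key : (Matrix.of fun r => (Fin.cons (B r (S.orderEmbOfFin h p))
      (fun q => B r (S.orderEmbOfFin h q)) : Fin (m + 1) → ℝ)).det = 0 :=
    Matrix.det_zero_of_column_eq (i := 0) (j := p.succ) (Fin.succ_ne_zero p).symm
      (fun r => by simp)
  rw [Matrix.det_succ_column_zero] at key
  rw [pluckerForm_apply, ← key]
  refine Finset.sum_congr rfl fun r _ => ?_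
  congr 2

/-- Laplace expansion along the column `a`; the sign moves this column to the front. -/
theorem pluckerForm_erase {n m : ℕ} (B : Matrix (Fin (m + 1)) (Fin n) ℝ) {A : Finset (Fin n)}
    {a : Fin n} (ha : a ∈ A) (h : (A.erase a).card = m) :
    pluckerForm B (A.erase a) h (fun r => B r a) = (-1) ^ below A a * plucker B A := by
  have hA : A.card = m + 1 := by
    rw [Finset.card_erase_of_mem ha] at h
    have := Finset.card_pos.2 ⟨a, ha⟩
    omega
  obtain ⟨p, rfl⟩ := exists_orderEmbOfFin_eq hA ha
  rw [below_orderEmbOfFin, plucker_of_card B hA, Matrix.det_succ_column _ p, pluckerForm_apply,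
    orderEmbOfFin_erase, Finset.mul_sum]
  refine Finset.sum_congr rfl fun r _ => ?_
  rw [pow_add, Matrix.submatrix_submatrix]
  simp only [Matrix.submatrix_apply, id, Function.id_comp]
  have : ((-1 : ℝ) ^ (p : ℕ)) * (-1) ^ (p : ℕ) = 1 := by rw [← mul_pow]; simp
  linear_combination (-((-1) ^ (r : ℕ) * B r (A.orderEmbOfFin hA p) *
    (B.submatrix r.succAbove (A.orderEmbOfFin hA ∘ p.succAbove)).det)) * this

/-- Any `k + 1` columns of `B` satisfy the linear relation given by Cramer's rule. -/
theorem sum_plucker_erase_mul {n k : ℕ} (B : Matrix (Fin k) (Fin n) ℝ) {A : Finset (Fin n)}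
    (hA : A.card = k + 1) (r : Fin k) :
    ∑ a ∈ A, (-1) ^ below A a * plucker B (A.erase a) * B r a = 0 := by
  -- The columns `A`, with the row `r` repeated on top, have determinant zero.
  have key : (Matrix.of (Fin.cons (fun q => B r (A.orderEmbOfFin hA q))
      (fun s q => B s (A.orderEmbOfFin hA q)) : Fin (k + 1) → Fin (k + 1) → ℝ)).det = 0 :=
    Matrix.det_zero_of_row_eq (i := 0) (j := r.succ) (Fin.succ_ne_zero r).symm
      (by ext q; simp)
  rw [Matrix.det_succ_row_zero] at key
  rw [sum_eq_sum_orderEmbOfFin A hA, ← key]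
  refine Finset.sum_congr rfl fun p _ => ?_
  have hc : (A.erase (A.orderEmbOfFin hA p)).card = k := by
    rw [Finset.card_erase_of_mem (Finset.orderEmbOfFin_mem _ _ _), hA]; rfl
  rw [below_orderEmbOfFin, plucker_of_card B hc, orderEmbOfFin_erase hA p hc]
  rw [mul_right_comm]
  congr 2

theorem symmDiff_singleton_of_mem {n : ℕ} {A : Finset (Fin n)} {i : Fin n} (h : i ∈ A) :
    A ∆ {i} = A.erase i := by
  ext x
  simp only [Finset.mem_symmDiff, Finset.mem_singleton, Finset.mem_erase]
  by_cases hx : x = i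
  · subst hx; tauto
  · tauto

theorem symmDiff_singleton_of_notMem {n : ℕ} {A : Finset (Fin n)} {i : Fin n} (h : i ∉ A) :
    A ∆ {i} = insert i A := by
  ext x
  simp only [Finset.mem_symmDiff, Finset.mem_singleton, Finset.mem_insert]
  by_cases hx : x = i
  · subst hx; tauto
  · tauto

/-- The number of elements of `A ∆ B` below `i` has the parity of those numbers for `A` and `B`
together, since the elements of `A ∩ B` count twice; the minus sign is the contribution of `i`. -/
theorem neg_one_pow_filter_symmDiff {n : ℕ} {A B : Finset (Fin n)} {i : Fin n}
    (hi : i ∈ A ∆ B) : (-1 : ℝ) ^ ((A ∆ B).filter (· ≤ i)).card =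
      -((-1) ^ below A i * (-1) ^ below B i) := by
  have h2 : (A ∆ B).filter (· < i) = A.filter (· < i) ∆ B.filter (· < i) := by
    ext x
    simp only [Finset.mem_filter, Finset.mem_symmDiff]
    tauto
  have h4 := card_symmDiff_add_card_inter (A.filter (· < i)) (B.filter (· < i))
  rw [card_filter_le_of_mem hi, ← pow_add, pow_succ]
  unfold below
  rw [h2, ← h4, pow_add, pow_mul]
  simp

/-- Up to an exchange of `X` and `Y`, these are the only sizes for which the Grassmann–Plücker
relation has non-zero terms. The linear form of `Y` is applied to the linear relation
between the columns `X`. -/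
theorem sum_plucker_symmDiff_of_card {n k : ℕ} (B : Matrix (Fin k) (Fin n) ℝ)
    {X Y : Finset (Fin n)} (hX : X.card = k + 1) (hY : Y.card + 1 = k) :
    ∑ i ∈ X ∆ Y, (-1) ^ ((X ∆ Y).filter (· ≤ i)).card *
      (plucker B (X ∆ {i}) * plucker B (Y ∆ {i})) = 0 := by
  subst hY
  have h1 := congrArg (pluckerForm B Y rfl) (funext (sum_plucker_erase_mul B hX) :
    (fun r => ∑ a ∈ X, (-1) ^ below X a * plucker B (X.erase a) * B r a) = 0)
  have h2 : (fun r => ∑ a ∈ X, (-1) ^ below X a * plucker B (X.erase a) * B r a) =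
      ∑ a ∈ X, ((-1) ^ below X a * plucker B (X.erase a)) • (fun r => B r a) := by
    ext r
    simp [Finset.sum_apply]
  rw [h2, map_sum, map_zero] at h1
  simp only [map_smul, smul_eq_mul] at h1
  have h3 : X ∆ Y = X \ Y ∪ Y \ X := rfl
  have h4 : ∀ i ∈ Y \ X, (-1) ^ ((X ∆ Y).filter (· ≤ i)).card *
      (plucker B (X ∆ {i}) * plucker B (Y ∆ {i})) = 0 := by
    intro i hi
    have hi' := (Finset.mem_sdiff.1 hi).2
    rw [symmDiff_singleton_of_notMem hi', plucker_of_card_ne B, zero_mul, mul_zero]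
    rw [Finset.card_insert_of_notMem hi', hX]
    omega
  -- The terms of `Y \ X` vanish in the relation, those of `X ∩ Y` in `h1`.
  rw [← Finset.sum_subset (h3 ▸ Finset.subset_union_left : X \ Y ⊆ X ∆ Y)]
  · rw [← Finset.sum_subset (Finset.sdiff_subset : X \ Y ⊆ X)] at h1
    · rw [← neg_eq_zero, ← Finset.sum_neg_distrib, ← h1]
      refine Finset.sum_congr rfl fun i hi => ?_
      obtain ⟨hiX, hiY⟩ := Finset.mem_sdiff.1 hi
      rw [neg_one_pow_filter_symmDiff (Finset.mem_symmDiff.2 (Or.inl ⟨hiX, hiY⟩)),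
        symmDiff_singleton_of_mem hiX, symmDiff_singleton_of_notMem hiY]
      have h5 := pluckerForm_erase B (Finset.mem_insert_self i Y)
        (by rw [Finset.erase_insert hiY])
      rw [← below_erase_of_le le_rfl] at h5
      simp only [Finset.erase_insert hiY] at h5
      rw [h5]
      ring
    · intro i hiX hi
      have hiY : i ∈ Y := by
        by_contra h
        exact hi (Finset.mem_sdiff.2 ⟨hiX, h⟩)
      rw [pluckerForm_of_mem B rfl hiY, mul_zero]
  · intro i hi hi'
    refine h4 i ?_
    rw [h3] at hi
    exact (Finset.mem_union.1 hi).resolve_left hi'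

/-- The Grassmann–Plücker relations, written in terms of symmetric differences as the relations
between the Pfaffian minors of a skew-symmetric matrix are. -/
theorem sum_plucker_symmDiff {n k : ℕ} (B : Matrix (Fin k) (Fin n) ℝ) (X Y : Finset (Fin n)) :
    ∑ i ∈ X ∆ Y, (-1) ^ ((X ∆ Y).filter (· ≤ i)).card *
      (plucker B (X ∆ {i}) * plucker B (Y ∆ {i})) = 0 := by
  by_cases h1 : X.card = k + 1 ∧ Y.card + 1 = k
  · exact sum_plucker_symmDiff_of_card B h1.1 h1.2
  by_cases h2 : Y.card = k + 1 ∧ X.card + 1 = k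
  · have := sum_plucker_symmDiff_of_card B h2.1 h2.2
    rw [symmDiff_comm, ← this]
    exact Finset.sum_congr rfl fun i _ => by ring
  refine Finset.sum_eq_zero fun i hi => ?_
  by_contra h
  have hX := card_of_plucker_ne_zero (left_ne_zero_of_mul (right_ne_zero_of_mul h))
  have hY := card_of_plucker_ne_zero (right_ne_zero_of_mul (right_ne_zero_of_mul h))
  rcases Finset.mem_symmDiff.1 hi with ⟨ha, hb⟩ | ⟨ha, hb⟩
  all_goals
    rw [symmDiff_singleton_of_mem ha, Finset.card_erase_of_mem ha] at *
    rw [symmDiff_singleton_of_notMem hb, Finset.card_insert_of_notMem hb] at *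
    have := Finset.card_pos.2 ⟨i, ha⟩
    omega

/-! ### Expansion of Pfaffians -/

/-- The permutation of `{0, …, N + 1}` that fixes `0`, sends `1` to `j + 1`, and permutes the
remaining positions as `σ` does. -/
def pfaffianPerm {N : ℕ} (j : Fin (N + 1)) (σ : Equiv.Perm (Fin N)) :
    Equiv.Perm (Fin (N + 2)) :=
  Equiv.Perm.decomposeFin.symm (0, j.cycleRange⁻¹ * Equiv.Perm.decomposeFin.symm (0, σ))

theorem pfaffianPerm_zero {N : ℕ} (j : Fin (N + 1)) (σ : Equiv.Perm (Fin N)) :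
    pfaffianPerm j σ 0 = 0 := by
  simp [pfaffianPerm]

theorem pfaffianPerm_one {N : ℕ} (j : Fin (N + 1)) (σ : Equiv.Perm (Fin N)) :
    pfaffianPerm j σ 1 = j.succ := by
  rw [← Fin.succ_zero_eq_one, pfaffianPerm, Equiv.Perm.decomposeFin_symm_apply_succ]
  simp [Equiv.Perm.inv_def, Fin.cycleRange_symm_zero]

theorem pfaffianPerm_succ_succ {N : ℕ} (j : Fin (N + 1)) (σ : Equiv.Perm (Fin N)) (i : Fin N) :
    pfaffianPerm j σ i.succ.succ = (j.succAbove (σ i)).succ := by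
  rw [pfaffianPerm, Equiv.Perm.decomposeFin_symm_apply_succ]
  simp [Equiv.Perm.inv_def, Fin.cycleRange_symm_succ]

theorem sign_pfaffianPerm {N : ℕ} (j : Fin (N + 1)) (σ : Equiv.Perm (Fin N)) :
    Equiv.Perm.sign (pfaffianPerm j σ) = (-1) ^ (j : ℕ) * Equiv.Perm.sign σ := by
  simp [pfaffianPerm, Fin.sign_cycleRange]

theorem exists_pfaffianPerm {N : ℕ} (τ : Equiv.Perm (Fin (N + 2))) (h : τ 0 = 0) :
    ∃ j σ, pfaffianPerm j σ = τ := by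
  obtain ⟨⟨p, τ₁⟩, rfl⟩ := Equiv.Perm.decomposeFin.symm.surjective τ
  obtain rfl : p = 0 := by simpa using h
  obtain ⟨⟨q, σ⟩, hσ⟩ :=
    Equiv.Perm.decomposeFin.symm.surjective ((τ₁ 0).cycleRange * τ₁)
  obtain rfl : q = 0 := by
    have := congrArg (fun e => e 0) hσ
    simpa using this
  refine ⟨τ₁ 0, σ, ?_⟩
  rw [pfaffianPerm, hσ, inv_mul_cancel_left]

/-- Expansion of the Pfaffian along the first row. -/
theorem pfaffian_succ {m : ℕ} (A : Matrix (Fin (2 * (m + 1))) (Fin (2 * (m + 1))) ℝ) :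
    pfaffian A = ∑ j : Fin (2 * m + 1), (-1) ^ (j : ℕ) *
      A (0 : Fin (2 * m + 2)) j.succ * pfaffian (m := m)
        (A.submatrix (fun i : Fin (2 * m) => (j.succAbove i).succ)
          (fun i : Fin (2 * m) => (j.succAbove i).succ)) := by
  unfold pfaffian
  simp only [Finset.mul_sum]
  rw [Finset.sum_sigma']
  symm
  -- The condition on `σ` at `k = 0` says `σ 0 = 0`, so `σ` comes from `j = σ 1 - 1` and the rest.
  refine Finset.sum_bij (fun x _ => (pfaffianPerm (N := 2 * m) x.1 x.2 :
    Equiv.Perm (Fin (2 * m + 2)))) ?_ ?_ ?_ ?_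
  · rintro ⟨j, σ⟩ hx
    simp only [Finset.mem_sigma, Finset.mem_univ, true_and, Finset.mem_filter] at hx ⊢
    intro k i hki
    induction k using Fin.cases with
    | zero =>
      have : (⟨2 * ((0 : Fin (m + 1)) : ℕ), by omega⟩ : Fin (2 * m + 2)) = 0 := by ext; simp
      erw [this, pfaffianPerm_zero]
      exact Fin.zero_le _
    | succ k =>
      have hk : (⟨2 * (k.succ : ℕ), by omega⟩ : Fin (2 * m + 2)) =
          (⟨2 * k, by omega⟩ : Fin (2 * m)).succ.succ := by ext; simp; omega
      have hi : ∃ i' : Fin (2 * m), (i : Fin (2 * m + 2)) = i'.succ.succ := by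
        have := i.2
        rw [Fin.val_succ] at hki
        exact ⟨⟨i - 2, by omega⟩, by ext; simp; omega⟩
      obtain ⟨i', rfl⟩ := hi
      erw [hk, pfaffianPerm_succ_succ, pfaffianPerm_succ_succ]
      rw [Fin.succ_le_succ_iff, (Fin.strictMono_succAbove j).le_iff_le]
      apply hx
      simp only [Fin.val_succ] at hki
      omega
  · rintro ⟨j, σ⟩ _ ⟨j', σ'⟩ _ h
    have h1 := congrArg (fun e : Equiv.Perm (Fin (2 * m + 2)) => e 1) h
    simp only [pfaffianPerm_one, Fin.succ_inj] at h1
    subst h1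
    have : σ = σ' := by
      ext i : 1
      have h2 := congrArg (fun e : Equiv.Perm (Fin (2 * m + 2)) => e i.succ.succ) h
      simpa [pfaffianPerm_succ_succ] using h2
    rw [this]
  · intro τ hτ
    simp only [Finset.mem_univ, true_and, Finset.mem_filter] at hτ
    have h0 : (τ : Equiv.Perm (Fin (2 * m + 2))) 0 = 0 := by
      obtain ⟨i, hi⟩ := τ.surjective (0 : Fin (2 * m + 2))
      have := hτ 0 i (by simp)
      rw [hi] at this
      exact le_antisymm this (Fin.zero_le _)
    obtain ⟨j, σ, rfl⟩ := exists_pfaffianPerm (N := 2 * m) τ h0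
    refine ⟨⟨j, σ⟩, ?_, rfl⟩
    simp only [Finset.mem_sigma, Finset.mem_univ, true_and, Finset.mem_filter]
    intro k i hki
    have := hτ k.succ (i.succ.succ : Fin (2 * m + 2)) (by simp; omega)
    have hk : (⟨2 * (k.succ : ℕ), by omega⟩ : Fin (2 * m + 2)) =
          (⟨2 * k, by omega⟩ : Fin (2 * m)).succ.succ := by ext; simp; omega
    erw [hk, pfaffianPerm_succ_succ, pfaffianPerm_succ_succ] at this
    rwa [Fin.succ_le_succ_iff, (Fin.strictMono_succAbove j).le_iff_le] at this
  · rintro ⟨j, σ⟩ _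
    rw [Fin.prod_univ_succ]
    have e0 : (⟨2 * ((0 : Fin (m + 1)) : ℕ), by omega⟩ : Fin (2 * m + 2)) = 0 := by ext; simp
    have e1 : (⟨2 * ((0 : Fin (m + 1)) : ℕ) + 1, by omega⟩ : Fin (2 * m + 2)) = 1 := by
      ext; simp
    have e2 : ∀ k : Fin m, (⟨2 * (k.succ : ℕ), by omega⟩ : Fin (2 * m + 2)) =
          (⟨2 * k, by omega⟩ : Fin (2 * m)).succ.succ := by intro k; ext; simp; omega
    have e3 : ∀ k : Fin m, (⟨2 * (k.succ : ℕ) + 1, by omega⟩ : Fin (2 * m + 2)) =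
          (⟨2 * k + 1, by omega⟩ : Fin (2 * m)).succ.succ := by intro k; ext; simp; omega
    erw [sign_pfaffianPerm, e0, e1, pfaffianPerm_zero, pfaffianPerm_one]
    have e4 : ∀ k : Fin m,
        A (pfaffianPerm j σ ⟨2 * (k.succ : ℕ), by omega⟩)
          (pfaffianPerm j σ ⟨2 * (k.succ : ℕ) + 1, by omega⟩) =
        A.submatrix (fun i : Fin (2 * m) => (j.succAbove i).succ)
          (fun i : Fin (2 * m) => (j.succAbove i).succ)
          (σ ⟨2 * k, by omega⟩) (σ ⟨2 * k + 1, by omega⟩) := by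
      intro k
      rw [e2, e3, pfaffianPerm_succ_succ, pfaffianPerm_succ_succ]
      rfl
    erw [Finset.prod_congr rfl fun k _ => e4 k]
    push_cast
    ring

theorem pfaffianMinor_of_card {n m : ℕ} (A : Matrix (Fin n) (Fin n) ℝ) {S : Finset (Fin n)}
    (h : S.card = 2 * m) :
    pfaffianMinor A S = pfaffian (A.submatrix (S.orderEmbOfFin h) (S.orderEmbOfFin h)) := by
  obtain rfl : m = S.card / 2 := by omega
  exact dif_pos h

theorem pfaffianMinor_of_odd {n : ℕ} (A : Matrix (Fin n) (Fin n) ℝ) {S : Finset (Fin n)}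
    (h : Odd S.card) : pfaffianMinor A S = 0 := by
  refine dif_neg fun h' => ?_
  obtain ⟨c, hc⟩ := h
  omega

theorem pfaffianMinor_empty {n : ℕ} (A : Matrix (Fin n) (Fin n) ℝ) : pfaffianMinor A ∅ = 1 := by
  rw [pfaffianMinor_of_card A (m := 0) rfl, pfaffian, Finset.filter_true_of_mem]
  · simp
  · intro σ _ k
    exact k.elim0

/-- Expansion of a Pfaffian minor along its first row. -/
theorem pfaffianMinor_eq_sum {n : ℕ} (A : Matrix (Fin n) (Fin n) ℝ) {S : Finset (Fin n)}
    (hS : Even S.card) {a : Fin n} (ha : a ∈ S) (hmin : ∀ b ∈ S, a ≤ b) :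
    pfaffianMinor A S = ∑ b ∈ S.erase a, (-1) ^ below (S.erase a) b *
      A a b * pfaffianMinor A ((S.erase a).erase b) := by
  obtain ⟨m, hm⟩ : ∃ m, S.card = 2 * (m + 1) := by
    obtain ⟨c, hc⟩ := hS
    have := Finset.card_pos.2 ⟨a, ha⟩
    exact ⟨c - 1, by omega⟩
  have hm' : S.card = 2 * m + 1 + 1 := hm
  have h0 : S.orderEmbOfFin hm' 0 = a := by
    refine le_antisymm ?_ (hmin _ (Finset.orderEmbOfFin_mem _ _ _))
    obtain ⟨p, rfl⟩ := exists_orderEmbOfFin_eq hm' ha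
    exact (S.orderEmbOfFin hm').monotone (Fin.zero_le p)
  have hc : (S.erase a).card = 2 * m + 1 := by rw [Finset.card_erase_of_mem ha, hm']; rfl
  have he : ⇑((S.erase a).orderEmbOfFin hc) = S.orderEmbOfFin hm' ∘ Fin.succ := by
    subst h0
    exact orderEmbOfFin_erase hm' 0 hc
  rw [pfaffianMinor_of_card A hm, pfaffian_succ, sum_eq_sum_orderEmbOfFin _ hc]
  refine Finset.sum_congr rfl fun j _ => ?_
  have hc' : ((S.erase a).erase ((S.erase a).orderEmbOfFin hc j)).card = 2 * m := by
    rw [Finset.card_erase_of_mem (Finset.orderEmbOfFin_mem _ _ _), hc]; rfl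
  rw [below_orderEmbOfFin, pfaffianMinor_of_card A hc', orderEmbOfFin_erase hc j hc', he]
  congr 2
  rw [Matrix.submatrix_apply]
  congr 1

/-! ### Plücker coordinates as Pfaffian minors -/

/-- The relations between Pfaffian minors determine these minors by the entries of the
matrix: if `f` satisfies them, and `A` has above the diagonal the values of `f` at the sets that
differ from `T` in two elements, normalised by `f T`, then the Pfaffian minors of `A` are the
values of `f`, with the same normalisation. -/
theorem pfaffianMinor_eq_div {n : ℕ} (f : Finset (Fin n) → ℝ) (T : Finset (Fin n)) (hT : f T ≠ 0)
    (hodd : ∀ U : Finset (Fin n), Odd U.card → f (T ∆ U) = 0)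
    (hf : ∀ X Y : Finset (Fin n), ∑ i ∈ X ∆ Y, (-1) ^ ((X ∆ Y).filter (· ≤ i)).card *
      (f (X ∆ {i}) * f (Y ∆ {i})) = 0)
    (A : Matrix (Fin n) (Fin n) ℝ) (hA : ∀ i j, i < j → A i j * f T = f (T ∆ {i, j}))
    (U : Finset (Fin n)) : pfaffianMinor A U = f (T ∆ U) / f T := by
  induction hc : U.card using Nat.strong_induction_on generalizing U with
  | _ N ih =>
  subst hc
  rcases Nat.even_or_odd U.card with he | ho
  swap
  · rw [pfaffianMinor_of_odd A ho, hodd U ho, zero_div]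
  rcases U.eq_empty_or_nonempty with rfl | hne
  · rw [pfaffianMinor_empty, ← Finset.bot_eq_empty, symmDiff_bot, div_self hT]
  have ha := U.min'_mem hne
  have hmin : ∀ b ∈ U, U.min' hne ≤ b := fun b hb => U.min'_le b hb
  set a := U.min' hne
  rw [pfaffianMinor_eq_sum A he ha hmin, eq_div_iff hT]
  have hsd : (T ∆ {a}) ∆ (T ∆ (U.erase a)) = U := by
    rw [← symmDiff_singleton_of_mem ha, symmDiff_symmDiff_symmDiff_comm, symmDiff_self,
      bot_symmDiff, symmDiff_comm, symmDiff_symmDiff_cancel_right]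
  -- The relation for these two sets, whose difference is `U`, is the expansion of the Pfaffian
  -- minor `U` along its first row, with `f T * f (T ∆ U)` as the term of the first index `a`.
  have hrel := hf (T ∆ {a}) (T ∆ (U.erase a))
  rw [hsd, ← Finset.add_sum_erase U _ ha, symmDiff_symmDiff_cancel_right, symmDiff_assoc,
    symmDiff_singleton_of_notMem (Finset.notMem_erase a U), Finset.insert_erase ha] at hrel
  have hpos : ∀ b ∈ U, U.filter (· ≤ b) = insert a ((U.erase a).filter (· ≤ b)) := by
    intro b hb
    ext x
    simp only [Finset.mem_filter, Finset.mem_insert, Finset.mem_erase]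
    constructor
    · rintro ⟨h1, h2⟩
      by_cases hx : x = a
      · exact Or.inl hx
      · exact Or.inr ⟨⟨hx, h1⟩, h2⟩
    · rintro (rfl | h)
      · exact ⟨ha, hmin b hb⟩
      · exact ⟨h.1.2, h.2⟩
  have hpos' : ∀ b ∈ U.erase a, (U.filter (· ≤ b)).card = below (U.erase a) b + 2 := by
    intro b hb
    rw [hpos b (Finset.mem_of_mem_erase hb), Finset.card_insert_of_notMem (by simp)]
    rw [card_filter_le_of_mem hb]
  have hposa : (U.filter (· ≤ a)).card = 1 := by
    rw [Finset.card_eq_one]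
    refine ⟨a, ?_⟩
    ext x
    simp only [Finset.mem_filter, Finset.mem_singleton]
    exact ⟨fun h => le_antisymm h.2 (hmin x h.1), fun h => by subst h; exact ⟨ha, le_rfl⟩⟩
  rw [hposa] at hrel
  have hsum : ∑ b ∈ U.erase a, (-1) ^ (U.filter (· ≤ b)).card *
      (f ((T ∆ {a}) ∆ {b}) * f ((T ∆ U.erase a) ∆ {b})) =
      f T * ((∑ b ∈ U.erase a, (-1) ^ below (U.erase a) b *
      A a b * pfaffianMinor A ((U.erase a).erase b)) * f T) := by
    rw [Finset.sum_mul, Finset.mul_sum]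
    refine Finset.sum_congr rfl fun b hb => ?_
    have hbU := Finset.mem_of_mem_erase hb
    have hba := Finset.ne_of_mem_erase hb
    have hab : a < b := lt_of_le_of_ne (hmin b hbU) hba.symm
    have hlt : ((U.erase a).erase b).card < U.card :=
      (Finset.card_erase_le).trans_lt (Finset.card_erase_lt_of_mem ha)
    rw [hpos' b hb, ih _ hlt _ rfl, symmDiff_assoc T, symmDiff_assoc T,
      symmDiff_singleton_of_mem hb]
    have hpair : ({a} : Finset (Fin n)) ∆ {b} = {a, b} := by
      rw [symmDiff_singleton_of_notMem (by simpa using hba), Finset.pair_comm]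
    rw [hpair, ← hA a b hab, pow_add]
    field_simp
  rw [hsum] at hrel
  apply mul_left_cancel₀ hT
  linear_combination hrel

/-! ### Row reduction of the block matrix -/

theorem orthogonal_span_iff {n k : ℕ} (B : Matrix (Fin k) (Fin n) ℝ) (v : Fin n → ℝ) :
    (∀ u ∈ Submodule.span ℝ (Set.range B.row), u ⬝ᵥ v = 0) ↔ B.mulVec v = 0 := by
  constructor
  · intro h
    ext r
    exact h _ (Submodule.subset_span ⟨r, rfl⟩)
  · intro h u hu
    induction hu using Submodule.span_induction with
    | mem x hx =>
      obtain ⟨r, rfl⟩ := hx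
      exact congrFun h r
    | zero => simp
    | add x y _ _ hx hy => rw [add_dotProduct, hx, hy, add_zero]
    | smul c x _ hx => rw [smul_dotProduct, hx, smul_zero]

theorem linearIndependent_row_of_plucker_ne_zero {n k : ℕ} {B : Matrix (Fin k) (Fin n) ℝ}
    {T : Finset (Fin n)} (hT : plucker B T ≠ 0) : LinearIndependent ℝ B.row := by
  have h := card_of_plucker_ne_zero hT
  rw [plucker_of_card B h] at hT
  rw [← Matrix.vecMul_injective_iff, ← Matrix.coe_vecMulLinear, ← LinearMap.ker_eq_bot,
    LinearMap.ker_eq_bot']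
  intro y hy
  refine Matrix.eq_zero_of_vecMul_eq_zero hT ?_
  ext q
  exact congrFun hy (T.orderEmbOfFin h q)

theorem IsOrthogonalComplement.card_add {n k l : ℕ} {B : Matrix (Fin k) (Fin n) ℝ}
    {D : Matrix (Fin l) (Fin n) ℝ} (hD : IsOrthogonalComplement B D)
    (hB : LinearIndependent ℝ B.row) : k + l = n := by
  have h1 : Submodule.span ℝ (Set.range D.row) = LinearMap.ker B.mulVecLin := by
    ext v
    rw [hD.2, orthogonal_span_iff]
    rfl
  have h2 := finrank_span_eq_card hD.1
  have h3 := LinearMap.finrank_range_add_finrank_ker B.mulVecLin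
  have h4 : Module.finrank ℝ (LinearMap.range B.mulVecLin) = k := by
    have := hB.rank_matrix
    rwa [Fintype.card_fin] at this
  rw [← h1, h2, h4] at h3
  simpa using h3

/-- For a basis `T`, there is a matrix `Y` whose rows at `T` are the linear forms dual to the
columns `T` of `B`; then `Y * B` holds the coordinates of the columns of `B` in this basis. -/
theorem exists_dual_rows {n k : ℕ} {B : Matrix (Fin k) (Fin n) ℝ} {T : Finset (Fin n)}
    (hT : plucker B T ≠ 0) : ∃ Y : Matrix (Fin n) (Fin k) ℝ,
      (∀ t ∈ T, ∀ s ∈ T, (Y * B) t s = if t = s then 1 else 0) ∧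
      ∀ r c, B r c = ∑ t ∈ T, B r t * (Y * B) t c := by
  have h := card_of_plucker_ne_zero hT
  rw [plucker_of_card B h] at hT
  set S := B.submatrix id (T.orderEmbOfFin h) with hS
  have hu : IsUnit S.det := isUnit_iff_ne_zero.2 hT
  let Y : Matrix (Fin n) (Fin k) ℝ := Matrix.of fun t r =>
    if ht : t ∈ T then S⁻¹ ((T.orderIsoOfFin h).symm ⟨t, ht⟩) r else 0
  have hY : ∀ p c, (Y * B) (T.orderEmbOfFin h p) c = (S⁻¹ * B) p c := by
    intro p c
    simp only [Matrix.mul_apply]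
    refine Finset.sum_congr rfl fun r _ => ?_
    congr 1
    have hp : (T.orderIsoOfFin h).symm ⟨T.orderEmbOfFin h p, Finset.orderEmbOfFin_mem _ _ _⟩ = p :=
      (T.orderIsoOfFin h).symm_apply_apply p
    simp only [Y, Matrix.of_apply]
    rw [dif_pos (Finset.orderEmbOfFin_mem _ _ _), hp]
  refine ⟨Y, ?_, ?_⟩
  · intro t ht s hs
    obtain ⟨p, rfl⟩ := exists_orderEmbOfFin_eq h ht
    obtain ⟨q, rfl⟩ := exists_orderEmbOfFin_eq h hs
    have h1 := congrFun (congrFun (Matrix.nonsing_inv_mul S hu) p) q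
    rw [hY]
    rw [Matrix.one_apply] at h1
    simp only [EmbeddingLike.apply_eq_iff_eq]
    rw [← h1]
    rfl
  · intro r c
    rw [sum_eq_sum_orderEmbOfFin T h]
    simp only [hY]
    have h1 : S * (S⁻¹ * B) = B := by rw [← Matrix.mul_assoc, Matrix.mul_nonsing_inv S hu,
      Matrix.one_mul]
    exact (congrFun (congrFun h1 r) c).symm

/-- Exchanging the element `t` of the basis `T` for `j` multiplies the Plücker coordinate by the
coordinate of the column `j` at `t`, up to the sign that reorders the columns. -/
theorem plucker_exchange {n k : ℕ} {B : Matrix (Fin k) (Fin n) ℝ} {T : Finset (Fin n)}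
    (hT : T.card = k) {Y : Matrix (Fin n) (Fin k) ℝ}
    (hY : ∀ r c, B r c = ∑ t ∈ T, B r t * (Y * B) t c) {t j : Fin n} (ht : t ∈ T) (hj : j ∉ T) :
    (-1) ^ below (T.erase t) j * plucker B (insert j (T.erase t)) =
      (Y * B) t j * ((-1) ^ below T t * plucker B T) := by
  obtain ⟨m, rfl⟩ : ∃ m, k = m + 1 := ⟨k - 1, by have := Finset.card_pos.2 ⟨t, ht⟩; omega⟩
  have hc : (T.erase t).card = m := by rw [Finset.card_erase_of_mem ht, hT]; rfl
  have hj' : j ∉ T.erase t := fun h => hj (Finset.mem_of_mem_erase h)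
  have h1 : (fun r => B r j) = ∑ s ∈ T, (Y * B) s j • (fun r => B r s) := by
    ext r
    rw [hY]
    simp [Finset.sum_apply, mul_comm]
  have h2 := congrArg (pluckerForm B (T.erase t) hc) h1
  rw [map_sum] at h2
  simp only [map_smul, smul_eq_mul] at h2
  rw [Finset.sum_eq_single t, pluckerForm_erase B ht hc] at h2
  · rw [← h2]
    have h3 := pluckerForm_erase B (Finset.mem_insert_self j (T.erase t))
      (by rw [Finset.erase_insert hj', hc])
    rw [← below_erase_of_le le_rfl] at h3
    simp only [Finset.erase_insert hj'] at h3
    exact h3.symm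
  · intro s hs hst
    rw [pluckerForm_of_mem B hc (Finset.mem_erase.2 ⟨hst, hs⟩), mul_zero]
  · exact fun h => absurd ht h

/-- The skew-symmetric matrix made of the block `(Y * B)_{T, Tᶜ}`, minus its transpose, and zero
blocks at `T × T` and `Tᶜ × Tᶜ`. -/
def skewBlock {n k : ℕ} (B : Matrix (Fin k) (Fin n) ℝ) (T : Finset (Fin n))
    (Y : Matrix (Fin n) (Fin k) ℝ) : Matrix (Fin n) (Fin n) ℝ :=
  Matrix.of fun i j =>
    if i ∈ T then (if j ∈ T then 0 else (Y * B) i j) else (if j ∈ T then -(Y * B) j i else 0)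

theorem eps_of_mem {n : ℕ} {T : Finset (Fin n)} {i : Fin n} (h : i ∈ T) :
    eps T i = -(-1) ^ below T i := by
  rw [eps, card_filter_le_of_mem h, pow_succ]
  ring

theorem eps_of_notMem {n : ℕ} {T : Finset (Fin n)} {i : Fin n} (h : i ∉ T) :
    eps T i = (-1) ^ below T i := by
  rw [eps, below]
  congr 2
  refine Finset.filter_congr fun x hx => ⟨fun h' => lt_of_le_of_ne h' ?_, le_of_lt⟩
  rintro rfl
  exact h hx

theorem below_eq_below_erase_add_one {n : ℕ} {T : Finset (Fin n)} {t j : Fin n} (ht : t ∈ T)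
    (h : t < j) : below T j = below (T.erase t) j + 1 := by
  unfold below
  have h1 : (T.erase t).filter (· < j) = (T.filter (· < j)).erase t := by
    ext x
    simp only [Finset.mem_filter, Finset.mem_erase]
    tauto
  rw [h1, Finset.card_erase_of_mem (Finset.mem_filter.2 ⟨ht, h⟩)]
  have := Finset.card_pos.2 ⟨t, (Finset.mem_filter (p := (· < j))).2 ⟨ht, h⟩⟩
  omega

theorem symmDiff_pair_of_mem_of_notMem {n : ℕ} {T : Finset (Fin n)} {t j : Fin n} (ht : t ∈ T)
    (hj : j ∉ T) : T ∆ {t, j} = insert j (T.erase t) := by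
  ext x
  simp only [Finset.mem_symmDiff, Finset.mem_singleton, Finset.mem_insert, Finset.mem_erase]
  by_cases h1 : x = t
  · subst h1
    have : x ≠ j := fun h => hj (h ▸ ht)
    tauto
  · by_cases h2 : x = j
    · subst h2; tauto
    · tauto

/-- The signs `ε_i ε_j` are the ones that reorder the columns after an exchange. -/
theorem twist_skewBlock_mul {n k : ℕ} {B : Matrix (Fin k) (Fin n) ℝ} {T : Finset (Fin n)}
    (hT : T.card = k) {Y : Matrix (Fin n) (Fin k) ℝ}
    (hY : ∀ r c, B r c = ∑ t ∈ T, B r t * (Y * B) t c) {i j : Fin n} (hij : i < j) :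
    twist T (skewBlock B T Y) i j * plucker B T = plucker B (T ∆ {i, j}) := by
  have hsq : ∀ a : ℕ, ((-1 : ℝ) ^ a) * (-1) ^ a = 1 := fun a => by rw [← mul_pow]; simp
  simp only [twist, skewBlock, Matrix.of_apply]
  by_cases hi : i ∈ T <;> by_cases hj : j ∈ T
  · simp only [hi, hj, if_true, mul_zero, zero_mul]
    rw [plucker_of_card_ne]
    have h1 : T ∆ {i, j} = (T.erase i).erase j := by
      ext x
      simp only [Finset.mem_symmDiff, Finset.mem_singleton, Finset.mem_insert, Finset.mem_erase]
      by_cases h1 : x = i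
      · subst h1; tauto
      · by_cases h2 : x = j
        · subst h2; tauto
        · tauto
    have h2 := Finset.card_erase_lt_of_mem hi
    have h3 := Finset.card_erase_le (s := T.erase i) (a := j)
    rw [h1]
    omega
  · have h1 := plucker_exchange hT hY hi hj
    simp only [hi, hj, if_true, if_false]
    rw [symmDiff_pair_of_mem_of_notMem hi hj, eps_of_mem hi, eps_of_notMem hj,
      below_eq_below_erase_add_one hi hij, pow_succ]
    linear_combination -(-1) ^ below (T.erase i) j * h1 +
      plucker B (insert j (T.erase i)) * hsq (below (T.erase i) j)
  · have h1 := plucker_exchange hT hY hj hi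
    simp only [hi, hj, if_true, if_false]
    rw [Finset.pair_comm, symmDiff_pair_of_mem_of_notMem hj hi, eps_of_mem hj, eps_of_notMem hi,
      ← below_erase_of_le (T := T) hij.le]
    linear_combination -(-1) ^ below (T.erase j) i * h1 +
      plucker B (insert i (T.erase j)) * hsq (below (T.erase j) i)
  · simp only [hi, hj, if_false, mul_zero, zero_mul]
    rw [plucker_of_card_ne]
    have h1 : T ∆ {i, j} = insert i (insert j T) := by
      ext x
      simp only [Finset.mem_symmDiff, Finset.mem_singleton, Finset.mem_insert]
      by_cases h1 : x = i
      · subst h1; tauto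
      · by_cases h2 : x = j
        · subst h2; tauto
        · tauto
    rw [h1, Finset.card_insert_of_notMem (by simp [hi, hij.ne]), Finset.card_insert_of_notMem hj]
    omega

/-- The Pfaffian minors of the twisted block matrix are the Plücker coordinates of `B`, normalised
at `T`. -/
theorem pfaffianMinor_twist_skewBlock {n k : ℕ} {B : Matrix (Fin k) (Fin n) ℝ}
    {T : Finset (Fin n)} (hT : plucker B T ≠ 0) {Y : Matrix (Fin n) (Fin k) ℝ}
    (hY : ∀ r c, B r c = ∑ t ∈ T, B r t * (Y * B) t c) (U : Finset (Fin n)) :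
    pfaffianMinor (twist T (skewBlock B T Y)) U = plucker B (T ∆ U) / plucker B T := by
  have hc := card_of_plucker_ne_zero hT
  refine pfaffianMinor_eq_div (plucker B) T hT ?_ (sum_plucker_symmDiff B) _
    (fun i j hij => twist_skewBlock_mul hc hY hij) U
  intro U hU
  refine plucker_of_card_ne B fun h => ?_
  have := card_symmDiff_add_card_inter T U
  rw [Nat.odd_iff] at hU
  omega

/-- The row reduction of the swapped matrix: the rows of `(B 0)` are reduced by the dual rows
`Y`, and the rows of `(0 D)` to the basis of the orthogonal complement of the row space of `B`
that the coordinates `Y * B` provide. -/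
theorem rowReducesTo_skewBlock {n k l : ℕ} {B : Matrix (Fin k) (Fin n) ℝ}
    {D : Matrix (Fin l) (Fin n) ℝ} (hD : IsOrthogonalComplement B D) {T : Finset (Fin n)}
    (hT : plucker B T ≠ 0) {Y : Matrix (Fin n) (Fin k) ℝ}
    (hY' : ∀ t ∈ T, ∀ s ∈ T, (Y * B) t s = if t = s then 1 else 0)
    (hY : ∀ r c, B r c = ∑ t ∈ T, B r t * (Y * B) t c) :
    RowReducesTo (swapColumns (Matrix.fromBlocks B 0 0 D) T) (skewBlock B T Y) := by
  have hcard := hD.card_add (linearIndependent_row_of_plucker_ne_zero hT)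
  -- For `i ∉ T`, the linear relation between the column `i` and the columns `T` of `B` is a vector
  -- of the orthogonal complement, hence a combination of the rows of `D`.
  have hE : ∀ i : Fin n, ∃ E : Fin l → ℝ, i ∉ T → ∀ c, ∑ r, E r * D r c =
      if c ∈ T then -(Y * B) c i else if i = c then 1 else 0 := by
    intro i
    by_cases hi : i ∈ T
    · exact ⟨0, fun h => absurd hi h⟩
    have hmem : (fun c => if c ∈ T then -(Y * B) c i else if i = c then 1 else 0) ∈
        Submodule.span ℝ (Set.range D.row) := by
      rw [hD.2, orthogonal_span_iff]
      ext r
      have h1 : ∀ c, B r c * (if c ∈ T then -(Y * B) c i else if i = c then 1 else 0) =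
          (if i = c then B r c else 0) - (if c ∈ T then B r c * (Y * B) c i else 0) := by
        intro c
        by_cases hc : c ∈ T
        · have : i ≠ c := fun h => hi (h ▸ hc)
          simp [hc, this]
        · simp [hc]
      simp only [Matrix.mulVec, dotProduct, h1, Finset.sum_sub_distrib, Finset.sum_ite_eq,
        Finset.mem_univ, if_true, Finset.sum_ite_mem, Finset.univ_inter, Pi.zero_apply]
      rw [← hY r i, sub_self]
    obtain ⟨E, hE⟩ := (Submodule.mem_span_range_iff_exists_fun ℝ).1 hmem
    refine ⟨E, fun _ c => ?_⟩
    have := congrFun hE c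
    simpa [Finset.sum_apply] using this
  choose E hE using hE
  let R : Matrix (Fin n) (Fin k ⊕ Fin l) ℝ := Matrix.of fun i =>
    if i ∈ T then Sum.elim (Y i) 0 else Sum.elim 0 (E i)
  set C := swapColumns (Matrix.fromBlocks B 0 0 D) T with hC
  have hRC : R * C = Matrix.fromCols (skewBlock B T Y) (1 : Matrix (Fin n) (Fin n) ℝ) := by
    ext i (c | c)
    · rw [Matrix.mul_apply, Fintype.sum_sum_type]
      by_cases hi : i ∈ T <;> by_cases hc : c ∈ T
      · simp [R, hC, swapColumns, skewBlock, hi, hc]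
      · simp [R, hC, swapColumns, skewBlock, hi, hc, Matrix.mul_apply]
      · simp [R, hC, swapColumns, skewBlock, hi, hc, hE i hi c]
      · simp [R, hC, swapColumns, skewBlock, hi, hc]
    · rw [Matrix.mul_apply, Fintype.sum_sum_type]
      by_cases hi : i ∈ T <;> by_cases hc : c ∈ T
      · have := hY' i hi c hc
        rw [Matrix.mul_apply] at this
        simp [R, hC, swapColumns, hi, hc, this, Matrix.one_apply]
      · have : i ≠ c := fun h => hc (h ▸ hi)
        simp [R, hC, swapColumns, hi, hc, this]
      · have : i ≠ c := fun h => hi (h ▸ hc)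
        simp [R, hC, swapColumns, hi, hc, this]
      · simp [R, hC, swapColumns, hi, hc, hE i hi c, Matrix.one_apply]
  let Q : Matrix (Fin k ⊕ Fin l) (Fin n) ℝ := C.submatrix id Sum.inr
  have hRQ : R * Q = 1 := by
    ext i c
    exact congrFun (congrFun hRC i) (Sum.inr c)
  refine ⟨R, Q, hRQ, ?_, hRC⟩
  exact (Matrix.mul_eq_one_comm_of_card_eq _ _ _ (by simp [hcard])).1 hRQ

/-! ### Bases of the block matrix -/

theorem completion_toLeft {n : ℕ} (F : LagrangianSet n) : completion F.1.toLeft = F := by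
  refine Subtype.ext (Finset.eq_of_subset_of_card_le ?_ ?_).symm
  · rintro (c | c) hc
    · simpa [completion] using hc
    · have h := Finset.disjoint_left.1 F.2.1 hc
      have : (Sum.inl c : J n) ∉ F.1 := fun h' => h (Finset.mem_image.2 ⟨_, h', rfl⟩)
      simpa [completion] using this
  · rw [F.2.2, (completion F.1.toLeft).2.2]

theorem toLeft_completion {n : ℕ} (A : Finset (Fin n)) : (completion A).1.toLeft = A := by
  ext x
  simp [completion]

theorem inr_mem_iff {n : ℕ} (F : LagrangianSet n) (c : Fin n) :
    (Sum.inr c : J n) ∈ F.1 ↔ (Sum.inl c : J n) ∉ F.1 := by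
  conv_lhs => rw [← completion_toLeft F]
  simp [completion]

/-- After the swap, the starred columns are those of `F`, and row reduction to `(A 1)` inverts the
square matrix they form. -/
theorem isBasisOf_of_rowReducesTo {n : ℕ} {ρ : Type} [Fintype ρ] [DecidableEq ρ]
    {C : Matrix ρ (J n) ℝ} (hρ : Fintype.card ρ = n) {F : LagrangianSet n}
    {A : Matrix (Fin n) (Fin n) ℝ} (h : RowReducesTo (swapColumns C F.1.toLeft) A) :
    IsBasisOf C F := by
  obtain ⟨R, _, _, _, hRC⟩ := h
  let φ : Fin n → F.1 := fun c =>
    if hc : (Sum.inl c : J n) ∈ F.1 then ⟨Sum.inl c, hc⟩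
    else ⟨Sum.inr c, (inr_mem_iff F c).2 hc⟩
  have hφ : ∀ c, (φ c : J n) = if (Sum.inl c : J n) ∈ F.1 then Sum.inl c else Sum.inr c := by
    intro c
    by_cases hc : (Sum.inl c : J n) ∈ F.1 <;> simp [φ, hc]
  have hinj : Function.Injective φ := by
    intro c d hcd
    have h1 : (φ c : J n) = φ d := by rw [hcd]
    rw [hφ, hφ] at h1
    have h2 := congrArg (Sum.elim id id) h1
    simpa [apply_ite] using h2
  have hbij : Function.Bijective φ :=
    (Fintype.bijective_iff_injective_and_card φ).2 ⟨hinj, by simp [F.2.2]⟩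
  let g : ρ ≃ Fin n := Fintype.equivOfCardEq (by simp [hρ])
  refine ⟨g.trans (Equiv.ofBijective φ hbij), ?_⟩
  have h1 : R.submatrix g id * C.submatrix id
      (fun r => ((g.trans (Equiv.ofBijective φ hbij) r : F.1) : J n)) = 1 := by
    ext r s
    have h2 := congrFun (congrFun hRC (g r)) (Sum.inr (g s))
    simp only [Matrix.mul_apply, Matrix.fromCols_apply_inr, Matrix.one_apply,
      EmbeddingLike.apply_eq_iff_eq] at h2
    rw [Matrix.mul_apply, Matrix.one_apply, ← h2]
    refine Finset.sum_congr rfl fun x _ => ?_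
    congr 1
    simp only [Matrix.submatrix_apply, id, Equiv.trans_apply, Equiv.ofBijective_apply, hφ,
      swapColumns, Matrix.of_apply, Sum.elim_inr]
    by_cases hs : (Sum.inl (g s) : J n) ∈ F.1 <;> simp [hs]
  intro h0
  have := congrArg Matrix.det h1
  rw [Matrix.det_mul, h0, mul_zero, Matrix.det_one] at this
  exact zero_ne_one this

/-- A non-zero minor of the block matrix with columns `F` makes the rows of the two blocks
independent on `F ∩ I` and on `F ∩ I^*`. As `k + l = n`, this forces `F ∩ I` to have `k`
elements. -/
theorem plucker_ne_zero_of_isBasisOf {n k l : ℕ} {B : Matrix (Fin k) (Fin n) ℝ}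
    {D : Matrix (Fin l) (Fin n) ℝ} (hcard : k + l = n) {F : LagrangianSet n}
    (hF : IsBasisOf (Matrix.fromBlocks B 0 0 D) F) : plucker B F.1.toLeft ≠ 0 := by
  obtain ⟨e, he⟩ := hF
  have hker : ∀ y : Fin k ⊕ Fin l → ℝ,
      (∀ c ∈ F.1, ∑ r, y r * Matrix.fromBlocks B 0 0 D r c = 0) → y = 0 := by
    intro y hy
    refine Matrix.eq_zero_of_vecMul_eq_zero he ?_
    ext r
    exact hy _ (e r).2
  have hB : ∀ y : Fin k → ℝ, (∀ c ∈ F.1.toLeft, ∑ r, y r * B r c = 0) → y = 0 := by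
    intro y hy
    have := hker (Sum.elim y 0) (by
      rintro (c | c) hc
      · simpa using hy c (Finset.mem_toLeft.2 hc)
      · simp)
    ext r
    simpa using congrFun this (Sum.inl r)
  have hD : ∀ y : Fin l → ℝ, (∀ c ∈ F.1.toRight, ∑ r, y r * D r c = 0) → y = 0 := by
    intro y hy
    have := hker (Sum.elim 0 y) (by
      rintro (c | c) hc
      · simp
      · simpa using hy c (Finset.mem_toRight.2 hc))
    ext r
    simpa using congrFun this (Sum.inr r)
  have hle : ∀ {m : ℕ} (G : Matrix (Fin m) (Fin n) ℝ) (S : Finset (Fin n)),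
      (∀ y : Fin m → ℝ, (∀ c ∈ S, ∑ r, y r * G r c = 0) → y = 0) → m ≤ S.card := by
    intro m G S h
    have hinj : Function.Injective (G.submatrix id (Subtype.val : S → Fin n)).vecMulLinear := by
      rw [← LinearMap.ker_eq_bot, LinearMap.ker_eq_bot']
      intro y hy
      exact h y fun c hc => congrFun hy ⟨c, hc⟩
    simpa using LinearMap.finrank_le_finrank_of_injective hinj
  have h1 := hle B _ hB
  have h2 := hle D _ hD
  have h3 := F.1.card_toLeft_add_card_toRight
  rw [F.2.2] at h3
  have h4 : F.1.toLeft.card = k := by omega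
  rw [plucker_of_card B h4]
  intro h0
  obtain ⟨y, hy0, hy⟩ := Matrix.exists_vecMul_eq_zero_iff.2 h0
  refine hy0 (hB y fun c hc => ?_)
  obtain ⟨p, rfl⟩ := exists_orderEmbOfFin_eq h4 hc
  exact congrFun hy p

/-! ### The row space is Lagrangian -/

theorem isLagrangianMatrix_fromBlocks {n k l : ℕ} {B : Matrix (Fin k) (Fin n) ℝ}
    {D : Matrix (Fin l) (Fin n) ℝ} (hD : IsOrthogonalComplement B D)
    (hB : LinearIndependent ℝ B.row) : IsLagrangianMatrix (Matrix.fromBlocks B 0 0 D) := by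
  refine ⟨by simpa using hD.card_add hB, ?_, ?_⟩
  · rw [← Matrix.vecMul_injective_iff, ← Matrix.coe_vecMulLinear, ← LinearMap.ker_eq_bot,
      LinearMap.ker_eq_bot']
    intro y hy
    have h1 := Matrix.vecMul_injective_iff.2 hB
    have h2 := Matrix.vecMul_injective_iff.2 hD.1
    have h3 : (fun r => y (Sum.inl r)) = 0 := by
      apply h1
      ext c
      have := congrFun hy (Sum.inl c)
      simpa [Matrix.vecMul, dotProduct] using this
    have h4 : (fun r => y (Sum.inr r)) = 0 := by
      apply h2
      ext c
      have := congrFun hy (Sum.inr c)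
      simpa [Matrix.vecMul, dotProduct] using this
    ext (r | r)
    · exact congrFun h3 r
    · exact congrFun h4 r
  · have hspan : ∀ u ∈ Submodule.span ℝ (Set.range (Matrix.fromBlocks B 0 0 D).row),
        u ∘ Sum.inl ∈ Submodule.span ℝ (Set.range B.row) ∧
        u ∘ Sum.inr ∈ Submodule.span ℝ (Set.range D.row) := by
      intro u hu
      induction hu using Submodule.span_induction with
      | mem x hx =>
        obtain ⟨r | r, rfl⟩ := hx
        · exact ⟨Submodule.subset_span ⟨r, rfl⟩, Submodule.zero_mem _⟩
        · exact ⟨Submodule.zero_mem _, Submodule.subset_span ⟨r, rfl⟩⟩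
      | zero => exact ⟨Submodule.zero_mem _, Submodule.zero_mem _⟩
      | add x y _ _ hx hy =>
        exact ⟨Submodule.add_mem _ hx.1 hy.1, Submodule.add_mem _ hx.2 hy.2⟩
      | smul c x _ hx =>
        exact ⟨Submodule.smul_mem _ _ hx.1, Submodule.smul_mem _ _ hx.2⟩
    intro u hu v hv
    have h1 := (hD.2 _).1 (hspan v hv).2 _ (hspan u hu).1
    have h2 := (hD.2 _).1 (hspan u hu).2 _ (hspan v hv).1
    simp only [dotProduct, Function.comp] at h1 h2
    rw [orthForm, Fintype.sum_sum_type]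
    simp only [star, Sum.swap_inl, Sum.swap_inr]
    rw [h1, zero_add, ← h2]
    exact Finset.sum_congr rfl fun _ _ => mul_comm _ _

/-! ### Greedy bases -/

theorem linearIndependent_columns {n k : ℕ} {B : Matrix (Fin k) (Fin n) ℝ} {X : Finset (Fin n)}
    (hX : plucker B X ≠ 0) : LinearIndependent ℝ (fun x : X => B.col x) := by
  have h := card_of_plucker_ne_zero hX
  rw [plucker_of_card B h] at hX
  have h1 : LinearIndependent ℝ (B.submatrix id (X.orderEmbOfFin h)).col :=
    Matrix.linearIndependent_cols_iff_isUnit.2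
      ((Matrix.isUnit_iff_isUnit_det _).2 (isUnit_iff_ne_zero.2 hX))
  convert h1.comp _ (X.orderIsoOfFin h).symm.injective using 1
  ext x r
  have : X.orderEmbOfFin h ((X.orderIsoOfFin h).symm x) = x := by
    rw [← Finset.coe_orderIsoOfFin_apply, OrderIso.apply_symm_apply]
  exact (congrArg (B r) this).symm

/-- The greedy property of matroids: a basis of greatest total weight meets each set
`{e | c ≤ key e}` in as many elements as a basis can. -/
theorem exists_greedy_basis {n k : ℕ} {B : Matrix (Fin k) (Fin n) ℝ}
    (hB : ∃ T, plucker B T ≠ 0) (key : Fin n → ℤ) : ∃ Y, plucker B Y ≠ 0 ∧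
      ∀ X, plucker B X ≠ 0 → ∀ c : ℤ,
        (X.filter (c ≤ key ·)).card ≤ (Y.filter (c ≤ key ·)).card := by
  obtain ⟨T, hT⟩ := hB
  obtain ⟨Y, hY, hmax⟩ := Finset.exists_max_image
    (Finset.univ.filter fun S : Finset (Fin n) => plucker B S ≠ 0) (fun S => ∑ e ∈ S, key e)
    ⟨T, by simpa using hT⟩
  simp only [Finset.mem_filter, Finset.mem_univ, true_and] at hY hmax
  refine ⟨Y, hY, fun X hX c => ?_⟩
  by_contra hlt
  push Not at hlt
  -- Otherwise `X` has, above `c`, an element outside the span of the part of `Y` above `c`, and it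
  -- can replace a lighter element of `Y`.
  obtain ⟨x, hx, hxs⟩ : ∃ x ∈ X.filter (c ≤ key ·),
      B.col x ∉ Submodule.span ℝ ((Y.filter (c ≤ key ·)).image B.col : Set (Fin k → ℝ)) := by
    by_contra! hcon
    have hli : LinearIndependent ℝ (fun x : X.filter (c ≤ key ·) => B.col x) :=
      (linearIndependent_columns hX).comp
        (fun x : X.filter (c ≤ key ·) => (⟨x, (Finset.mem_filter.1 x.2).1⟩ : X))
        (fun a b h => Subtype.ext (congrArg (fun z : X => (z : Fin n)) h))
    have h1 := finrank_span_eq_card hli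
    have h2 : Submodule.span ℝ (Set.range fun x : X.filter (c ≤ key ·) => B.col x) ≤
        Submodule.span ℝ ((Y.filter (c ≤ key ·)).image B.col : Set (Fin k → ℝ)) := by
      rw [Submodule.span_le]
      rintro _ ⟨x, rfl⟩
      exact hcon x x.2
    have h3 := Submodule.finrank_mono h2
    have h4 := finrank_span_finset_le_card (R := ℝ) ((Y.filter (c ≤ key ·)).image B.col)
    have h5 := Finset.card_image_le (s := Y.filter (c ≤ key ·)) (f := B.col)
    rw [Fintype.card_coe] at h1
    unfold Set.finrank at h4
    omega
  obtain ⟨hxX, hcx⟩ := Finset.mem_filter.1 hx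
  have hxY : x ∉ Y := fun h => hxs (Submodule.subset_span (by
    simpa using ⟨x, ⟨h, hcx⟩, rfl⟩))
  obtain ⟨W, _, hW⟩ := exists_dual_rows hY
  obtain ⟨y, hyY, hyc, hyx⟩ : ∃ y ∈ Y, key y < c ∧ (W * B) y x ≠ 0 := by
    by_contra! hcon
    refine hxs ?_
    have h1 : B.col x = ∑ y ∈ Y, (W * B) y x • B.col y := by
      ext r
      simp only [Matrix.col, Finset.sum_apply, Pi.smul_apply, smul_eq_mul, Matrix.transpose_apply]
      rw [hW r x]
      exact Finset.sum_congr rfl fun _ _ => mul_comm _ _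
    rw [h1]
    refine Submodule.sum_mem _ fun y hy => ?_
    by_cases hyc : key y < c
    · rw [hcon y hy hyc, zero_smul]
      exact Submodule.zero_mem _
    · refine Submodule.smul_mem _ _ (Submodule.subset_span ?_)
      simpa using ⟨y, ⟨hy, not_lt.1 hyc⟩, rfl⟩
  have hex := plucker_exchange (card_of_plucker_ne_zero hY) hW hyY hxY
  have hne : plucker B (insert x (Y.erase y)) ≠ 0 := by
    intro h0
    rw [h0, mul_zero] at hex
    exact mul_ne_zero hyx (mul_ne_zero (by simp) hY) hex.symm
  have h1 := hmax _ hne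
  rw [Finset.sum_insert (fun h => hxY (Finset.mem_of_mem_erase h))] at h1
  have h2 := Finset.add_sum_erase Y key hyY
  linarith

/-! ### The Gale order -/

theorem card_filter_orderEmbOfFin_le {m : ℕ} (S : Finset ℕ) (h : S.card = m) (i : Fin m) :
    (S.filter (S.orderEmbOfFin h i ≤ ·)).card = m - i := by
  have : S.filter (S.orderEmbOfFin h i ≤ ·) =
      (Finset.Ici i).map (S.orderEmbOfFin h).toEmbedding := by
    ext a
    simp only [Finset.mem_filter, Finset.mem_map, Finset.mem_Ici]
    constructor
    · rintro ⟨ha, hle⟩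
      have : a ∈ Set.range (S.orderEmbOfFin h) := by rw [Finset.range_orderEmbOfFin]; exact ha
      obtain ⟨q, rfl⟩ := this
      exact ⟨q, (S.orderEmbOfFin h).le_iff_le.1 hle, rfl⟩
    · rintro ⟨q, hq, rfl⟩
      exact ⟨Finset.orderEmbOfFin_mem _ _ _, (S.orderEmbOfFin h).le_iff_le.2 hq⟩
  rw [this]
  simp

theorem card_filter_orderEmbOfFin_lt {m : ℕ} (S : Finset ℕ) (h : S.card = m) (i : Fin m) :
    (S.filter (S.orderEmbOfFin h i < ·)).card = m - 1 - i := by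
  have : S.filter (S.orderEmbOfFin h i < ·) =
      (S.filter (S.orderEmbOfFin h i ≤ ·)).erase (S.orderEmbOfFin h i) := by
    ext a
    simp only [Finset.mem_filter, Finset.mem_erase, lt_iff_le_and_ne]
    tauto
  rw [this, Finset.card_erase_of_mem (by simp), card_filter_orderEmbOfFin_le]
  omega

/-- Sorted lists compare entrywise when the sets have this comparison of their tails. -/
theorem orderEmbOfFin_le_of_card_filter_le {m : ℕ} {S T : Finset ℕ} (hS : S.card = m)
    (hT : T.card = m) (h : ∀ c, (S.filter (c ≤ ·)).card ≤ (T.filter (c ≤ ·)).card) (i : Fin m) :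
    S.orderEmbOfFin hS i ≤ T.orderEmbOfFin hT i := by
  by_contra! hlt
  have h1 := h (S.orderEmbOfFin hS i)
  rw [card_filter_orderEmbOfFin_le] at h1
  have h2 : (T.filter (S.orderEmbOfFin hS i ≤ ·)).card ≤
      (T.filter (T.orderEmbOfFin hT i < ·)).card :=
    Finset.card_le_card (Finset.monotone_filter_right T fun _ _ hx => hlt.trans_le hx)
  rw [card_filter_orderEmbOfFin_lt] at h2
  have := i.2
  omega

theorem star_mem_iff {n : ℕ} (F : LagrangianSet n) (c : J n) : star c ∈ F.1 ↔ c ∉ F.1 := by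
  rcases c with c | c
  · exact inr_mem_iff F c
  · rw [inr_mem_iff F c, not_not]
    rfl

/-- Forgetting the stars in a frame leaves a permutation of `I`. -/
theorem exists_frame_equiv {n : ℕ} {a : Fin n → J n} (ha : IsFrame a) :
    ∃ π : Fin n ≃ Fin n, ∀ i, a i = Sum.inl (π i) ∨ a i = Sum.inr (π i) := by
  have hinj : Function.Injective fun i => (Sum.elim id id (a i) : Fin n) := by
    intro i j (h : Sum.elim id id (a i) = Sum.elim id id (a j))
    have h1 := ha.2 i j
    apply ha.1
    revert h h1
    rcases a i with x | x <;> rcases a j with y | y <;> simp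
  refine ⟨Equiv.ofBijective _ (Finite.injective_iff_bijective.1 hinj), fun i => ?_⟩
  rw [Equiv.ofBijective_apply]
  rcases a i with x | x <;> simp

/-- A linear extension of the order of a frame: the elements `a_i` get the ranks `0, …, n - 1`,
and their partners the ranks `n, …, 2n - 1` in the opposite order. -/
theorem exists_rank {n : ℕ} {a : Fin n → J n} (ha : IsFrame a) :
    ∃ rank : J n → ℕ, (∀ i, rank (a i) = i) ∧ (∀ i, rank (star (a i)) = 2 * n - 1 - i) ∧
      ∀ c, ∃ i, c = a i ∨ c = star (a i) := by
  obtain ⟨π, hπ⟩ := exists_frame_equiv ha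
  have hcover : ∀ c, ∃ i, c = a i ∨ c = star (a i) := by
    intro c
    refine ⟨π.symm (Sum.elim id id c), ?_⟩
    rcases c with c | c <;> rcases hπ (π.symm c) with h | h <;> simp [h]
  have hex : ∀ c, ∃ q : ℕ, ∀ i, (c = a i → q = i) ∧ (c = star (a i) → q = 2 * n - 1 - i) := by
    intro c
    obtain ⟨i, rfl | rfl⟩ := hcover c
    · exact ⟨i, fun j => ⟨fun h => by rw [ha.1 h], fun h => absurd h (ha.2 i j)⟩⟩
    · refine ⟨2 * n - 1 - i, fun j => ⟨fun h => absurd h.symm (ha.2 j i), fun h => ?_⟩⟩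
      rw [ha.1 (Sum.swap_leftInverse.injective h)]
  choose rank hrank using hex
  exact ⟨rank, fun i => (hrank _ i).1 rfl, fun i => (hrank _ i).2 rfl, hcover⟩

/-- The number of partners `a_i^*` with `i` among the first `t` indices that lie in `F`. -/
def starCount {n : ℕ} (a : Fin n → J n) (F : LagrangianSet n) (t : ℕ) : ℕ :=
  (Finset.univ.filter fun i : Fin n => (i : ℕ) < t ∧ star (a i) ∈ F.1).card

/-- The tails of `F` in the linear extension have sizes given by the prefix counts: `F` contains
exactly one of `a_i` and `a_i^*`, so a tail that starts at an `a_i` misses as many elements as there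
are earlier indices not counted by `starCount`. -/
theorem card_filter_le_rank {n : ℕ} {a : Fin n → J n} (ha : IsFrame a) {rank : J n → ℕ}
    (h1 : ∀ i, rank (a i) = i) (h2 : ∀ i, rank (star (a i)) = 2 * n - 1 - i)
    (h3 : ∀ c, ∃ i, c = a i ∨ c = star (a i)) (F : LagrangianSet n) (c : ℕ) :
    (F.1.filter (c ≤ rank ·)).card =
      if n ≤ c then starCount a F (2 * n - c) else n - c + starCount a F c := by
  split_ifs with hc
  · have : F.1.filter (c ≤ rank ·) =
        (Finset.univ.filter fun i : Fin n =>
          (i : ℕ) < 2 * n - c ∧ star (a i) ∈ F.1).image (fun i => star (a i)) := by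
      ext x
      simp only [Finset.mem_filter, Finset.mem_image, Finset.mem_univ, true_and]
      constructor
      · rintro ⟨hx, hcx⟩
        obtain ⟨i, rfl | rfl⟩ := h3 x
        · rw [h1] at hcx
          omega
        · rw [h2] at hcx
          exact ⟨i, ⟨by omega, hx⟩, rfl⟩
      · rintro ⟨i, ⟨hi, hx⟩, rfl⟩
        exact ⟨hx, by rw [h2]; omega⟩
    rw [this, Finset.card_image_of_injective]
    · rfl
    · exact Sum.swap_leftInverse.injective.comp ha.1
  · have e1 : F.1.filter (fun x => ¬ c ≤ rank x) =
        (Finset.univ.filter fun i : Fin n => (i : ℕ) < c ∧ ¬ star (a i) ∈ F.1).image a := by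
      ext x
      simp only [Finset.mem_filter, Finset.mem_image, Finset.mem_univ, true_and, star_mem_iff,
        not_not]
      constructor
      · rintro ⟨hx, hcx⟩
        obtain ⟨i, rfl | rfl⟩ := h3 x
        · rw [h1] at hcx
          exact ⟨i, ⟨by omega, hx⟩, rfl⟩
        · rw [h2] at hcx
          omega
      · rintro ⟨i, ⟨hi, hx⟩, rfl⟩
        exact ⟨hx, by rw [h1]; omega⟩
    have e2 := Finset.card_filter_add_card_filter_not (s := F.1) (c ≤ rank ·)
    have e3 := Finset.card_filter_add_card_filter_not
      (s := Finset.univ.filter fun i : Fin n => (i : ℕ) < c) (fun i => star (a i) ∈ F.1)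
    have e4 : (Finset.univ.filter fun i : Fin n => (i : ℕ) < c).card = c := by
      rw [Fin.card_filter_val_lt]
      omega
    rw [Finset.filter_filter, Finset.filter_filter, e4] at e3
    rw [e1, Finset.card_image_of_injective _ ha.1, F.2.2] at e2
    unfold starCount
    omega

/-- A criterion for the Gale order: the prefix counts of partners increase, and the total counts
have the same parity. The parity excludes that the incomparable elements `a_n` and `a_n^*` meet
at the same place of the two lists. -/
theorem galeLE_of_starCount_le {n : ℕ} {a : Fin n → J n} (ha : IsFrame a) {X Y : LagrangianSet n}
    (hle : ∀ t ≤ n, starCount a X t ≤ starCount a Y t)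
    (hpar : starCount a X n % 2 = starCount a Y n % 2) : GaleLE a X Y := by
  obtain ⟨rank, h1, h2, h3⟩ := exists_rank ha
  have hinj : Function.Injective rank := by
    intro c d h
    obtain ⟨i, rfl | rfl⟩ := h3 c <;> obtain ⟨j, rfl | rfl⟩ := h3 d <;>
      simp only [h1, h2] at h <;> have := i.2 <;> have := j.2
    · rw [Fin.ext h]
    · omega
    · omega
    · rw [Fin.ext (by omega : (i : ℕ) = j)]
  have hlt : ∀ c d, rank c < rank d → ¬ (rank c + 1 = n ∧ rank d = n) → DLt a c d := by
    intro c d h hn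
    obtain ⟨i, rfl | rfl⟩ := h3 c <;> obtain ⟨j, rfl | rfl⟩ := h3 d <;>
      simp only [h1, h2] at h hn <;> have := i.2 <;> have := j.2
    · exact DLt.unstarred i j (Fin.lt_def.2 h)
    · exact DLt.mixed i j (by omega)
    · omega
    · exact DLt.starred j i (Fin.lt_def.2 (by omega))
  have hstar : ∀ c d, rank c + 1 = n → rank d = n → d = star c := by
    intro c d hc hd
    obtain ⟨i, rfl | rfl⟩ := h3 c
    · apply hinj
      rw [h1] at hc
      rw [h2]
      omega
    · rw [h2] at hc
      have := i.2
      omega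
  have hcard : ∀ F : LagrangianSet n, (F.1.image rank).card = n := fun F => by
    rw [Finset.card_image_of_injective _ hinj, F.2.2]
  have hfilter : ∀ (F : LagrangianSet n) (c : ℕ), ((F.1.image rank).filter (c ≤ ·)).card =
      if n ≤ c then starCount a F (2 * n - c) else n - c + starCount a F c := by
    intro F c
    rw [← card_filter_le_rank ha h1 h2 h3, Finset.filter_image,
      Finset.card_image_of_injective _ hinj]
  have hlist : ∀ F : LagrangianSet n, ∃ x : Fin n → J n,
      ∀ i, x i ∈ F.1 ∧ rank (x i) = (F.1.image rank).orderEmbOfFin (hcard F) i := by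
    intro F
    have : ∀ i, ∃ c ∈ F.1, rank c = (F.1.image rank).orderEmbOfFin (hcard F) i := fun i =>
      Finset.mem_image.1 (Finset.orderEmbOfFin_mem _ _ _)
    choose x hx using this
    exact ⟨x, hx⟩
  have hmono : ∀ (F : LagrangianSet n) (x : Fin n → J n), (∀ i, x i ∈ F.1 ∧
      rank (x i) = (F.1.image rank).orderEmbOfFin (hcard F) i) →
      (∀ i j, i < j → DLt a (x i) (x j)) ∧ Finset.univ.image x = F.1 := by
    intro F x hx
    constructor
    · intro i j hij
      refine hlt _ _ ?_ ?_
      · rw [(hx i).2, (hx j).2]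
        exact ((F.1.image rank).orderEmbOfFin (hcard F)).lt_iff_lt.2 hij
      · rintro ⟨hi, hj⟩
        have h4 := (hx j).1
        rw [hstar _ _ hi hj, star_mem_iff] at h4
        exact h4 (hx i).1
    · refine Finset.eq_of_subset_of_card_le ?_ ?_
      · intro c hc
        obtain ⟨i, _, rfl⟩ := Finset.mem_image.1 hc
        exact (hx i).1
      · rw [F.2.2, Finset.card_image_of_injective, Finset.card_univ, Fintype.card_fin]
        intro i j hij
        have := congrArg rank hij
        rw [(hx i).2, (hx j).2] at this
        exact ((F.1.image rank).orderEmbOfFin (hcard F)).injective this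
  obtain ⟨x, hx⟩ := hlist X
  obtain ⟨y, hy⟩ := hlist Y
  refine ⟨x, y, (hmono X x hx).1, (hmono Y y hy).1, (hmono X x hx).2, (hmono Y y hy).2,
    fun i => ?_⟩
  have h4 : rank (x i) ≤ rank (y i) := by
    rw [(hx i).2, (hy i).2]
    refine orderEmbOfFin_le_of_card_filter_le _ _ (fun c => ?_) i
    rw [hfilter, hfilter]
    split_ifs with hc
    · exact hle _ (by omega)
    · exact Nat.add_le_add_left (hle _ (by omega)) _
  rcases h4.eq_or_lt with h4 | h4
  · exact Or.inl (hinj h4)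
  -- If `x i = a_n` and `y i = a_n^*`, then `Y` contains exactly one partner more than `X`.
  refine Or.inr (hlt _ _ h4 ?_)
  rintro ⟨h5, h6⟩
  have h7 := card_filter_orderEmbOfFin_lt _ (hcard X) i
  have h8 := card_filter_orderEmbOfFin_le _ (hcard Y) i
  rw [← (hx i).2] at h7
  rw [← (hy i).2, h6, hfilter, if_pos le_rfl] at h8
  have h9 : (X.1.image rank).filter (rank (x i) < ·) = (X.1.image rank).filter (n ≤ ·) :=
    Finset.filter_congr fun q _ => by omega
  rw [h9, hfilter, if_pos le_rfl] at h7
  have e : 2 * n - n = n := by omega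
  rw [e] at h7 h8
  have := i.2
  omega

/-- The prefix counts of a frame are, up to a constant, sums of the sizes of two upper level sets
of a weight function on `I`: positive weights mark the elements that the frame wants in
`F ∩ I`, negative weights those that it wants in `F ∩ I^*`, and earlier elements are heavier. -/
theorem exists_key {n : ℕ} {a : Fin n → J n} (ha : IsFrame a) :
    ∃ (key : Fin n → ℤ) (ν : ℕ → ℕ), (∀ e, key e ≠ 0) ∧ ∀ (F : LagrangianSet n) (t : ℕ), t ≤ n →
      starCount a F t + F.1.toLeft.card =
        (F.1.toLeft.filter ((n : ℤ) - t + 1 ≤ key ·)).card +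
          (F.1.toLeft.filter (-((n : ℤ) - t) ≤ key ·)).card + ν t := by
  obtain ⟨π, hπ⟩ := exists_frame_equiv ha
  let key : Fin n → ℤ := fun e =>
    if a (π.symm e) = Sum.inr e then (n : ℤ) - (π.symm e : ℕ) else -((n : ℤ) - (π.symm e : ℕ))
  have hlt : ∀ e, ((π.symm e : Fin n) : ℤ) < n := fun e => by exact_mod_cast (π.symm e).2
  refine ⟨key, fun t => (Finset.univ.filter (fun e => key e ≤ -((n : ℤ) - t + 1))).card,
    fun e => ?_, fun F t ht => ?_⟩
  · have := hlt e
    simp only [key]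
    split_ifs <;> omega
  have e1 : starCount a F t =
      (Finset.univ.filter fun e => ((π.symm e : Fin n) : ℕ) < t ∧
        star (a (π.symm e)) ∈ F.1).card := by
    refine Finset.card_equiv π fun i => ?_
    simp
  have e2 : (Finset.univ.filter fun e => ((π.symm e : Fin n) : ℕ) < t ∧
        star (a (π.symm e)) ∈ F.1) =
      F.1.toLeft.filter ((n : ℤ) - t + 1 ≤ key ·) ∪
        (Finset.univ.filter (fun e => key e ≤ -((n : ℤ) - t + 1))) \ F.1.toLeft := by
    ext e
    have h1 := hlt e
    have h2 : ((π.symm e : Fin n) : ℕ) < t ↔ ((π.symm e : Fin n) : ℤ) < t := by norm_cast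
    have ht' : (t : ℤ) ≤ n := by exact_mod_cast ht
    simp only [Finset.mem_filter, Finset.mem_univ, true_and, Finset.mem_union, Finset.mem_sdiff,
      Finset.mem_toLeft, star_mem_iff, key, h2]
    rcases hπ (π.symm e) with h | h <;> rw [Equiv.apply_symm_apply] at h <;> rw [h]
    · simp only [reduceCtorEq, if_false]
      constructor
      · rintro ⟨h3, h4⟩
        exact Or.inr ⟨by omega, h4⟩
      · rintro (⟨_, h4⟩ | ⟨h3, h4⟩)
        · omega
        · exact ⟨by omega, h4⟩
    · simp only [if_true, inr_mem_iff, not_not]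
      constructor
      · rintro ⟨h3, h4⟩
        exact Or.inl ⟨h4, by omega⟩
      · rintro (⟨h3, h4⟩ | ⟨h3, _⟩)
        · exact ⟨by omega, h3⟩
        · omega
  have e3 : Disjoint (F.1.toLeft.filter ((n : ℤ) - t + 1 ≤ key ·))
      ((Finset.univ.filter (fun e => key e ≤ -((n : ℤ) - t + 1))) \ F.1.toLeft) :=
    Finset.disjoint_of_subset_left (Finset.filter_subset _ _) Finset.disjoint_sdiff
  have e4 := Finset.card_sdiff_add_card_inter
    (Finset.univ.filter (fun e => key e ≤ -((n : ℤ) - t + 1))) F.1.toLeft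
  have e5 : (Finset.univ.filter (fun e => key e ≤ -((n : ℤ) - t + 1))) ∩ F.1.toLeft =
      F.1.toLeft.filter (fun e => ¬ -((n : ℤ) - t) ≤ key e) := by
    ext e
    simp only [Finset.mem_filter, Finset.mem_univ, true_and, Finset.mem_inter, and_comm]
    refine and_congr_right fun _ => ?_
    omega
  have e6 := Finset.card_filter_add_card_filter_not (s := F.1.toLeft) (-((n : ℤ) - t) ≤ key ·)
  rw [e5] at e4
  rw [e1, e2, Finset.card_union_of_disjoint e3]
  simp only
  omega

/-- The bases of a represented matroid, completed by the stars of the other elements, form a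
Lagrangian orthogonal matroid: a greedy basis for the weights of a frame is the greatest one. -/
theorem isLagrangianOrthogonalMatroid_plucker {n k : ℕ} {B : Matrix (Fin k) (Fin n) ℝ}
    (hB : ∃ T, plucker B T ≠ 0) :
    IsLagrangianOrthogonalMatroid {F : LagrangianSet n | plucker B F.1.toLeft ≠ 0} := by
  intro a ha
  obtain ⟨key, ν, hkey, hcount⟩ := exists_key ha
  obtain ⟨Y, hY, hgreedy⟩ := exists_greedy_basis hB key
  refine ⟨completion Y, by simpa [toLeft_completion] using hY, fun X hX => ?_⟩
  have hX' : plucker B X.1.toLeft ≠ 0 := hX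
  have hcX := card_of_plucker_ne_zero hX'
  have hcY := card_of_plucker_ne_zero hY
  refine galeLE_of_starCount_le ha (fun t ht => ?_) ?_
  · have h1 := hcount X t ht
    have h2 := hcount (completion Y) t ht
    rw [toLeft_completion] at h2
    have h3 := hgreedy _ hX' ((n : ℤ) - t + 1)
    have h4 := hgreedy _ hX' (-((n : ℤ) - t))
    omega
  -- At `t = n` the two level sets coincide, because no weight is zero.
  · have h1 := hcount X n le_rfl
    have h2 := hcount (completion Y) n le_rfl
    rw [toLeft_completion] at h2
    have h3 : ∀ S : Finset (Fin n), S.filter (-((n : ℤ) - n) ≤ key ·) =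
        S.filter ((n : ℤ) - n + 1 ≤ key ·) := fun S =>
      Finset.filter_congr fun e _ => by have := hkey e; omega
    rw [h3] at h1 h2
    omega

/-! ### The sign map of a representable oriented matroid -/

/-- By the Grassmann–Plücker relations the real numbers with signs `κ_j` add up to zero, so they
vanish as soon as none is negative. -/
theorem isOrientedEvenDeltaMatroid_plucker {n k : ℕ} {B : Matrix (Fin k) (Fin n) ℝ}
    (hB : ∃ T, plucker B T ≠ 0) :
    IsOrientedEvenDeltaMatroid fun A => SignType.sign (plucker B A) where
  not_zero := by
    obtain ⟨T, hT⟩ := hB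
    exact ⟨T, sign_ne_zero.2 hT⟩
  parity A A' hA hA' := by
    rw [card_of_plucker_ne_zero (sign_ne_zero.1 hA), card_of_plucker_ne_zero (sign_ne_zero.1 hA')]
  exchange X Y w _ h := by
    have hsign : ∀ (m : ℕ) (x y : ℝ), w * (-1) ^ m * (SignType.sign x * SignType.sign y) =
        SignType.sign ((w : ℝ) * ((-1) ^ m * (x * y))) := by
      intro m x y
      have h1 : SignType.sign (w : ℝ) = w := by cases w <;> simp
      rw [sign_mul, sign_mul, sign_mul, h1, sign_pow, Left.sign_neg, sign_one, mul_assoc]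
    have hsum := sum_plucker_symmDiff B X Y
    have hsum' : ∑ i ∈ X ∆ Y, (w : ℝ) * ((-1) ^ ((X ∆ Y).filter (· ≤ i)).card *
        (plucker B (X ∆ {i}) * plucker B (Y ∆ {i}))) = 0 := by
      rw [← Finset.mul_sum, hsum, mul_zero]
    simp only [hsign] at h ⊢
    intro i hi
    rw [(Finset.sum_eq_zero_iff_of_nonneg fun i hi => sign_nonneg_iff.1 (h i hi)).1 hsum' i hi,
      sign_zero]

theorem Chirotope.onSets_eq_sign_plucker {n k : ℕ} {χ : Chirotope n k}
    {B : Matrix (Fin k) (Fin n) ℝ}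
    (hχ : ∀ S : Fin k → Fin n, χ.toFun S = SignType.sign (B.submatrix id S).det)
    (A : Finset (Fin n)) : χ.onSets A = SignType.sign (plucker B A) := by
  unfold Chirotope.onSets plucker
  split_ifs
  · exact hχ _
  · exact sign_zero.symm

/-- Independent columns in any order are independent in increasing order. -/
theorem exists_plucker_ne_zero {n k : ℕ} {B : Matrix (Fin k) (Fin n) ℝ} {x : Fin k → Fin n}
    (hx : (B.submatrix id x).det ≠ 0) : ∃ T, plucker B T ≠ 0 := by
  have hinj : Function.Injective x := by
    intro i j hij
    by_contra hne
    exact hx (Matrix.det_zero_of_column_eq hne fun r => by simp [hij])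
  have hc : (Finset.univ.image x).card = k := by
    rw [Finset.card_image_of_injective _ hinj, Finset.card_univ, Fintype.card_fin]
  refine ⟨Finset.univ.image x, ?_⟩
  rw [plucker_of_card B hc]
  intro h0
  obtain ⟨y, hy0, hy⟩ := Matrix.exists_vecMul_eq_zero_iff.2 h0
  refine hy0 (Matrix.eq_zero_of_vecMul_eq_zero hx ?_)
  ext i
  obtain ⟨p, hp⟩ := exists_orderEmbOfFin_eq hc
    (Finset.mem_image_of_mem x (Finset.mem_univ i))
  have := congrFun hy p
  simp only [Matrix.vecMul, dotProduct, Matrix.submatrix_apply, hp] at this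
  exact this

end OriOrth

theorem mainTheorem3 {n k l : ℕ} (M : OriOrth.OrientedMatroid n k)
    (B : Matrix (Fin k) (Fin n) ℝ) (hB : M.IsRepresentedBy B)
    (D : Matrix (Fin l) (Fin n) ℝ) (hD : OriOrth.IsOrthogonalComplement B D) :
    ∃ P : OriOrth.OrientedOrthogonalMatroid n,
      M.CorrespondsTo P ∧ P.IsRepresentedBy (Matrix.fromBlocks B 0 0 D) := by
  open OriOrth in
  obtain ⟨χ, hM, hχ⟩ := hB
  have hex : ∃ T, plucker B T ≠ 0 := by
    obtain ⟨x, hx⟩ := χ.not_zero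
    rw [hχ] at hx
    exact exists_plucker_ne_zero (sign_ne_zero.1 hx)
  have hrow := hex.elim fun T hT => linearIndependent_row_of_plucker_ne_zero hT
  let p : OrthogonalSignMap n :=
    { toFun := fun A => SignType.sign (plucker B A.1.toLeft)
      orthogonal := by
        simpa only [sign_ne_zero] using isLagrangianOrthogonalMatroid_plucker hex
      oriented := by
        simpa only [toLeft_completion] using isOrientedEvenDeltaMatroid_plucker hex }
  refine ⟨Quotient.mk _ p, ⟨χ, p, hM, rfl, fun A =>
    (Chirotope.onSets_eq_sign_plucker hχ _).symm⟩,
    isLagrangianMatrix_fromBlocks hD hrow, p, rfl, fun F => ⟨fun hF => ?_, fun hF => ?_⟩,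
    fun F hF => ?_⟩
  · have hT : plucker B F.1.toLeft ≠ 0 := sign_ne_zero.1 hF
    obtain ⟨Y, hY', hY⟩ := exists_dual_rows hT
    exact isBasisOf_of_rowReducesTo (by simpa using hD.card_add hrow)
      (rowReducesTo_skewBlock hD hT hY' hY)
  · exact sign_ne_zero.2 (plucker_ne_zero_of_isBasisOf (hD.card_add hrow) hF)
  · have hT := plucker_ne_zero_of_isBasisOf (hD.card_add hrow) hF
    obtain ⟨Y, hY', hY⟩ := exists_dual_rows hT
    refine ⟨skewBlock B F.1.toLeft Y, rowReducesTo_skewBlock hD hT hY' hY,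
      SignType.sign (plucker B F.1.toLeft), sign_ne_zero.2 hT, fun X => ?_⟩
    have hleft : (X.1 ∆ F.1).toLeft = X.1.toLeft ∆ F.1.toLeft := by
      ext i
      simp [Finset.mem_symmDiff]
    rw [pfaffianMinor_twist_skewBlock hT hY, hleft, symmDiff_comm X.1.toLeft,
      symmDiff_symmDiff_cancel_left, ← sign_mul, mul_div_cancel₀ _ hT]
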